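/- **Setting.** Metric spaces are small sets with a finite-valued metric, possibly empty. $\mathsf{Met}$ is the category of metric spaces and $1$-Lipschitz maps, and $\mathsf{tbMet}\subset\mathsf{Met}$ is the full subcategory of totally bounded spaces. Fibre products in $\mathsf{Met}$ carry the maximum metric. A metric space $X$ is identified with the presheaf $T\mapsto \mathrm{Hom}_{\mathsf{Met}}(T,X)$ on $\mathsf{tbMet}$, and a presheaf with its category of elements over $\mathsf{tbMet}$. * A $1$-Lipschitz map $f:X\to B$ is a *submetry* if it is surjective and $d^{H}_X(f^{-1}(b_0),f^{-1}(b_1))\le d_B(b_0,b_1)$ for all $b_0,b_1\in B$, where $d^H$ is the Hausdorff distance. It is *proper* if it is proper as a continuous map. * $f$ is a *local submetry* if every $x\in X$ admits $r>0$ such that $f(B_X(x',s))=B_Y(f(x'),s)$ whenever $d(x,x')<r$ and $0<s<r-d(x,x')$ (open balls; here $f:X\to Y$). * An *lsm covering* of $X\in\mathsf{tbMet}$ is a family of local submetries $f_i:U_i\to X$ in $\mathsf{tbMet}$ such that for all $x_1,x_2,x_3\in X$ and $\varepsilon>0$ there are an index $i$ and points $u_k\in f_i^{-1}(x_k)$ with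 $d(u_1,u_2)<d(x_1,x_2)+\varepsilon$ and $d(u_2,u_3)<d(x_2,x_3)+\varepsilon$. The *lsm topology* on $\mathsf{tbMet}$ is the Grothendieck topology whose covering sieves are those containing an lsm covering. Stacks in groupoids (categories fibred in groupoids with descent) are taken over this site; $1$- and $2$-morphisms are functors and natural transformations over $\mathsf{tbMet}$. * $\mathcal{GH}$ is the category over $\mathsf{tbMet}$ whose objects over $T$ are the proper submetries $P\to T$ in $\mathsf{Met}$, and whose morphisms are the cartesian squares in $\mathsf{Met}$. * $*$ is the one-point space and $2_r=\{0,r\}\subset\mathbb{R}$. The map $\iota_{0r}:*\to 2_r$ has value $0$, and for $r>s>0$ the map $\iota_{rs}:2_r\to 2_s$ sends $0\mapsto 0$, $r\mapsto s$. * A morphism $f:\mathcal X\to\mathcal Y$ of stacks in groupoids is a *formal submetry* if (i) $\mathcal X(*)\to\mathcal Y(*)$ is essentially surjective, and (ii) for all real $r>s>0$, all $x:*\to\mathcal X$, $g:2_s\to\mathcal Y$ and every $2$-isomorphism $\alpha:f\circ x\simeq g\circ\iota_{0s}$, there are $h:2_r\to\mathcal X$ and $2$-isomorphisms $\beta:h\circ\iota_{0r}\simeq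 x$ and $\gamma:f\circ h\simeq g\circ\iota_{rs}$ with $\alpha\circ(f\star\beta)=\gamma\star\iota_{0r}$. * A *naive metric stack* is a stack in groupoids over $\mathsf{tbMet}$ (lsm topology) that admits a formal submetry from some metric space. * The *Urysohn universal space* $\mathbb U$ is a separable complete metric space such that for every isometric embedding $i:A\to X$ of finite metric spaces and every isometric embedding $f:A\to\mathbb U$ there is an isometric embedding $\tilde f:X\to\mathbb U$ with $\tilde f\circ i=f$. * $\mathrm{Cpt}(\mathbb U)$ is the space of non-empty compact subsets of $\mathbb U$ with the Hausdorff distance. For $T\in\mathsf{tbMet}$, $\underline{\mathrm{Cpt}}(\mathbb U)(T)$ is the set of subsets $A\subset\mathbb U\times T$ whose projection $A\to T$ is a proper submetry; this is a presheaf in $T$ by base change. **Theorem.** The Urysohn universal space exists, and $\mathcal{GH}$ is a stack in groupoids over $\mathsf{tbMet}$ with the lsm topology. Let $\mathbb U$ be any Urysohn universal space. Then $\underline{\mathrm{Cpt}}(\mathbb U)$ and $\mathrm{Cpt}(\mathbb U)$ are stacks over this site, and the maps $$\underline{\mathrm{Cpt}}(\mathbb U)(T)\to\mathcal{GH}(T),\qquad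 [A\subset\mathbb U\times T]\mapsto[A\to T]\qquad (T\in\mathsf{tbMet})$$ define a morphism of stacks $p:\underline{\mathrm{Cpt}}(\mathbb U)\to\mathcal{GH}$. Assigning to $A$ the map $t\mapsto\{x : (x,t)\in A\}$ is an isomorphism $\eta:\underline{\mathrm{Cpt}}(\mathbb U)\simeq\mathrm{Cpt}(\mathbb U)$ of presheaves on $\mathsf{tbMet}$, and the resulting morphism, the *Urysohn chart* $$\pi_{\mathbb U}=p\circ\eta^{-1}:\mathrm{Cpt}(\mathbb U)\to\mathcal{GH},$$ is a formal submetry. In particular, $\mathcal{GH}$ is a naive metric stack. -/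

import Mathlib

open CategoryTheory Bicategory Opposite TopologicalSpace

universe u v w

namespace MetricStacks

noncomputable section

/-! ## Metric spaces and 1-Lipschitz maps -/

/-- A (small) metric space. -/
structure Met : Type (u + 1) where
  carrier : Type u
  [metric : MetricSpace carrier]

instance : CoeSort Met.{u} (Type u) := ⟨Met.carrier⟩

instance (X : Met.{u}) : MetricSpace X := X.metric

/-- A morphism of metric spaces is a 1-Lipschitz map. -/
@[ext]
structure Met.Hom (X Y : Met.{u}) : Type u where
  toFun : X → Y
  dist_le : ∀ x x' : X, dist (toFun x) (toFun x') ≤ dist x x'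

/-- The category of metric spaces and 1-Lipschitz maps. -/
instance : Category.{u} Met.{u} where
  Hom X Y := Met.Hom X Y
  id _ := ⟨fun x => x, fun _ _ => le_rfl⟩
  comp f g := ⟨fun x => g.toFun (f.toFun x), fun x x' =>
    (g.dist_le (f.toFun x) (f.toFun x')).trans (f.dist_le x x')⟩

instance (X Y : Met.{u}) : FunLike (X ⟶ Y) X Y where
  coe f := Met.Hom.toFun f
  coe_injective f g h := Met.Hom.ext (x := f) (y := g) h

theorem Met.hom_ext {X Y : Met.{u}} {f g : X ⟶ Y} (h : ∀ x, f x = g x) : f = g :=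
  DFunLike.ext f g h

/-- A totally bounded metric space. -/
structure TBMet : Type (u + 1) where
  toMet : Met.{u}
  totallyBounded : TotallyBounded (Set.univ : Set toMet)

/-- `TBMet` is the full subcategory of `Met` of the totally bounded metric spaces. -/
instance : Category.{u} TBMet.{u} where
  Hom X Y := X.toMet ⟶ Y.toMet
  id X := 𝟙 X.toMet
  comp f g := CategoryStruct.comp (obj := Met.{u}) f g

/-- The inclusion of `TBMet` into `Met`. -/
abbrev TBMet.incl : TBMet.{u} ⥤ Met.{u} where
  obj X := X.toMet
  map f := f

/-- A metric space `X`, regarded as the presheaf `T ↦ Hom(T, X)` on `TBMet`. -/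
def hMet : Met.{u} ⥤ TBMet.{u}ᵒᵖ ⥤ Type u :=
  yoneda ⋙ (Functor.whiskeringLeft _ _ _).obj TBMet.incl.op

/-- The one-point metric space `*`. -/
abbrev pt : Met.{u} := ⟨PUnit⟩

/-- The metric subspace `2_r = {0, r}` of the real line. -/
abbrev two (r : ℝ) : Met.{u} := ⟨ULift.{u} ({0, r} : Set ℝ)⟩

/-- `ι_{0r} : * ⟶ 2_r`, with value `0`. -/
def iotaZero (r : ℝ) : pt.{u} ⟶ two.{u} r :=
  Met.Hom.mk (fun _ => ⟨⟨0, by simp⟩⟩) (fun _ _ => (dist_self _).trans_le dist_nonneg)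

/-- `ι_{rs} : 2_r ⟶ 2_s` for `r > s > 0`, with `0 ↦ 0` and `r ↦ s`. -/
def iota {r s : ℝ} (hs : 0 < s) (hr : s < r) : two.{u} r ⟶ two.{u} s :=
  Met.Hom.mk (fun t => ⟨⟨if t.down.1 = 0 then 0 else s, by split <;> simp⟩⟩) (by
    rintro ⟨⟨a, ha⟩⟩ ⟨⟨b, hb⟩⟩
    simp only [Set.mem_insert_iff, Set.mem_singleton_iff] at ha hb
    have h0 : r ≠ 0 := (hs.trans hr).ne'
    change dist (if a = 0 then 0 else s) (if b = 0 then 0 else s) ≤ dist a b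
    rcases ha with rfl | rfl <;> rcases hb with rfl | rfl <;>
      simp [h0, Real.dist_eq, abs_of_pos hs, abs_of_pos (hs.trans hr), hr.le])

/-! ## Submetries -/

/-- A submetry: a surjective morphism such that the Hausdorff distance of any two fibres is at most
the distance of the two base points. -/
def IsSubmetry {X B : Met.{u}} (f : X ⟶ B) : Prop :=
  Function.Surjective f ∧
    ∀ b₀ b₁ : B, Metric.hausdorffEDist (f ⁻¹' {b₀}) (f ⁻¹' {b₁}) ≤ edist b₀ b₁

/-- A submetry whose underlying continuous map is proper. -/
def IsProperSubmetry {X B : Met.{u}} (f : X ⟶ B) : Prop :=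
  IsSubmetry f ∧ IsProperMap f

/-- A local submetry. -/
def IsLocalSubmetry {X Y : Met.{u}} (f : X ⟶ Y) : Prop :=
  ∀ x : X, ∃ r : ℝ, 0 < r ∧ ∀ x' ∈ Metric.ball x r, ∀ s : ℝ, 0 < s → s < r - dist x x' →
    f '' Metric.ball x' s = Metric.ball (f x') s

/-! ## The lsm topology on `TBMet` -/

/-- An lsm covering of `X`: a family of local submetries to `X` such that any three points of `X`
lift simultaneously, for any `δ > 0`, to one member of the family, with two of the distances
growing by less than `ε`. -/
def IsLsmCovering {X : TBMet.{u}} {I : Type u} (U : I → TBMet.{u}) (f : ∀ i, U i ⟶ X) : Prop :=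
  (∀ i, IsLocalSubmetry (TBMet.incl.map (f i))) ∧
    ∀ (x₁ x₂ x₃ : X.toMet) (δ : ℝ), 0 < δ →
      ∃ (i : I) (u₁ u₂ u₃ : (U i).toMet),
        TBMet.incl.map (f i) u₁ = x₁ ∧ TBMet.incl.map (f i) u₂ = x₂ ∧
        TBMet.incl.map (f i) u₃ = x₃ ∧
        dist u₁ u₂ < dist x₁ x₂ + δ ∧ dist u₂ u₃ < dist x₂ x₃ + δ

theorem IsLocalSubmetry.comp {X Y Z : Met.{u}} {f : X ⟶ Y} {g : Y ⟶ Z} (hf : IsLocalSubmetry f)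
    (hg : IsLocalSubmetry g) : IsLocalSubmetry (f ≫ g) := by
  intro x
  obtain ⟨r₁, h₁, H₁⟩ := hf x
  obtain ⟨r₂, h₂, H₂⟩ := hg (f x)
  refine ⟨min r₁ r₂, lt_min h₁ h₂, fun x' hx' s hs hsr => ?_⟩
  have hd : dist (f x) (f x') ≤ dist x x' := Met.Hom.dist_le f x x'
  have e : ((f ≫ g : X ⟶ Z) : X → Z) = g ∘ f := rfl
  rw [Metric.mem_ball, dist_comm] at hx'
  rw [e, Set.image_comp, H₁ x' (by
      rw [Metric.mem_ball, dist_comm]; exact hx'.trans_le (min_le_left _ _)) s hs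
      (hsr.trans_le (by gcongr; exact min_le_left _ _)),
    H₂ (f x') (by
      rw [Metric.mem_ball, dist_comm]
      exact (hd.trans_lt hx').trans_le (min_le_right _ _)) s hs
      (hsr.trans_le (by gcongr; exact min_le_right _ _))]
  rfl

/-- The fibre product `U ×_X Y` of totally bounded metric spaces, with the maximum distance. -/
def TBMet.fibreProd {U X Y : TBMet.{u}} (f : U ⟶ X) (q : Y ⟶ X) : TBMet.{u} where
  toMet := ⟨{z : U.toMet × Y.toMet // TBMet.incl.map f z.1 = TBMet.incl.map q z.2}⟩
  totallyBounded := by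
    have h : TotallyBounded (Set.univ : Set (U.toMet × Y.toMet)) := by
      refine Metric.totallyBounded_iff.2 fun δ hδ => ?_
      obtain ⟨s, hs, hs'⟩ := Metric.totallyBounded_iff.1 U.totallyBounded δ hδ
      obtain ⟨t, ht, ht'⟩ := Metric.totallyBounded_iff.1 Y.totallyBounded δ hδ
      refine ⟨s ×ˢ t, hs.prod ht, fun z _ => ?_⟩
      obtain ⟨a, ha, ha'⟩ := Set.mem_iUnion₂.1 (hs' (Set.mem_univ z.1))
      obtain ⟨b, hb, hb'⟩ := Set.mem_iUnion₂.1 (ht' (Set.mem_univ z.2))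
      exact Set.mem_iUnion₂.2 ⟨(a, b), ⟨ha, hb⟩, by rw [← ball_prod_same]; exact ⟨ha', hb'⟩⟩
    have := totallyBounded_preimage (f := (Subtype.val :
      {z : U.toMet × Y.toMet // TBMet.incl.map f z.1 = TBMet.incl.map q z.2} → _))
      isUniformEmbedding_subtype_val.isUniformInducing h
    simpa using this

/-- The second projection of the fibre product. -/
def TBMet.fibreProdSnd {U X Y : TBMet.{u}} (f : U ⟶ X) (q : Y ⟶ X) :
    TBMet.fibreProd f q ⟶ Y :=
  Met.Hom.mk (fun z => z.1.2) (fun _ _ => le_max_right _ _)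

/-- The first projection of the fibre product. -/
def TBMet.fibreProdFst {U X Y : TBMet.{u}} (f : U ⟶ X) (q : Y ⟶ X) :
    TBMet.fibreProd f q ⟶ U :=
  Met.Hom.mk (fun z => z.1.1) (fun _ _ => le_max_left _ _)

theorem TBMet.fibreProd_condition {U X Y : TBMet.{u}} (f : U ⟶ X) (q : Y ⟶ X) :
    TBMet.fibreProdFst f q ≫ f = TBMet.fibreProdSnd f q ≫ q :=
  Met.hom_ext (X := (TBMet.fibreProd f q).toMet) (Y := X.toMet) fun z => z.2

theorem isLocalSubmetry_fibreProdSnd {U X Y : TBMet.{u}} (f : U ⟶ X) (q : Y ⟶ X)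
    (hf : IsLocalSubmetry (TBMet.incl.map f)) :
    IsLocalSubmetry (TBMet.incl.map (TBMet.fibreProdSnd f q)) := by
  intro z
  obtain ⟨r, hr, H⟩ := hf z.1.1
  refine ⟨r, hr, fun z' hz' s hs hsr => ?_⟩
  have hfst : ∀ a b : (TBMet.fibreProd f q).toMet, dist a.1.1 b.1.1 ≤ dist a b :=
    fun a b => le_max_left _ _
  apply Set.Subset.antisymm
  · rintro _ ⟨a, ha, rfl⟩
    exact lt_of_le_of_lt (Met.Hom.dist_le (TBMet.fibreProdSnd f q) a z') ha
  · intro y hy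
    have h1 : z'.1.1 ∈ Metric.ball z.1.1 r := lt_of_le_of_lt (hfst z' z) hz'
    have h2 : s < r - dist z.1.1 z'.1.1 := hsr.trans_le (by gcongr; exact hfst z z')
    have h3 := H _ h1 s hs h2
    have h4 : TBMet.incl.map q y ∈ Metric.ball (TBMet.incl.map f z'.1.1) s := by
      rw [z'.2]
      exact lt_of_le_of_lt (Met.Hom.dist_le q y z'.1.2) hy
    rw [← h3] at h4
    obtain ⟨a, ha, hay⟩ := h4
    have hd : dist (⟨(a, y), hay⟩ : (TBMet.fibreProd f q).toMet) z' < s := max_lt ha hy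
    exact ⟨⟨(a, y), hay⟩, hd, rfl⟩

/-- The lsm topology: a sieve is covering if it contains an lsm covering. -/
def lsm : GrothendieckTopology TBMet.{u} where
  sieves X := {S | ∃ (I : Type u) (U : I → TBMet.{u}) (f : ∀ i, U i ⟶ X),
    IsLsmCovering U f ∧ ∀ i, S (f i)}
  top_mem' X := by
    refine ⟨PUnit, fun _ => X, fun _ => 𝟙 X, ⟨fun _ x => ⟨1, one_pos, fun x' _ s _ _ => ?_⟩,
      fun x₁ x₂ x₃ δ hδ => ⟨⟨⟩, x₁, x₂, x₃, rfl, rfl, rfl, by linarith, by linarith⟩⟩,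
      fun _ => trivial⟩
    exact Set.image_id _
  pullback_stable' := by
    rintro X Y S q ⟨I, U, f, ⟨h1, h2⟩, hS⟩
    refine ⟨I, fun i => TBMet.fibreProd (f i) q, fun i => TBMet.fibreProdSnd (f i) q,
      ⟨fun i => isLocalSubmetry_fibreProdSnd _ _ (h1 i), fun y₁ y₂ y₃ δ hδ => ?_⟩, fun i => ?_⟩
    · obtain ⟨i, u₁, u₂, u₃, e₁, e₂, e₃, d₁, d₂⟩ := h2 (TBMet.incl.map q y₁)
        (TBMet.incl.map q y₂) (TBMet.incl.map q y₃) δ hδ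
      have hq : ∀ a b : Y.toMet, dist (TBMet.incl.map q a) (TBMet.incl.map q b) ≤ dist a b :=
        fun a b => Met.Hom.dist_le q a b
      exact ⟨i, ⟨(u₁, y₁), e₁⟩, ⟨(u₂, y₂), e₂⟩, ⟨(u₃, y₃), e₃⟩, rfl, rfl, rfl,
        max_lt (d₁.trans_le (by gcongr; exact hq _ _)) (by linarith),
        max_lt (d₂.trans_le (by gcongr; exact hq _ _)) (by linarith)⟩
    · change S (TBMet.fibreProdSnd (f i) q ≫ q)
      rw [← TBMet.fibreProd_condition]
      exact S.downward_closed (hS i) _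
  transitive' := by
    rintro X S ⟨I, U, f, ⟨h1, h2⟩, hS⟩ R hR
    choose J V g hg hgR using fun i => hR (hS i)
    refine ⟨Σ i, J i, fun k => V k.1 k.2, fun k => g k.1 k.2 ≫ f k.1,
      ⟨fun k => IsLocalSubmetry.comp ((hg k.1).1 k.2) (h1 k.1), fun x₁ x₂ x₃ δ hδ => ?_⟩,
      fun k => hgR k.1 k.2⟩
    obtain ⟨i, u₁, u₂, u₃, rfl, rfl, rfl, d₁, d₂⟩ := h2 x₁ x₂ x₃ (δ / 2) (by linarith)
    obtain ⟨j, v₁, v₂, v₃, rfl, rfl, rfl, d₃, d₄⟩ := (hg i).2 u₁ u₂ u₃ (δ / 2) (by linarith)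
    exact ⟨⟨i, j⟩, v₁, v₂, v₃, rfl, rfl, rfl, by linarith, by linarith⟩

/-! ## Stacks in groupoids

Categories over `C`, functors over `C` and natural transformations over `C` are the objects,
1-morphisms and 2-morphisms of Mathlib's bicategory `BasedCategory C`. -/

section Stacks

variable {C : Type u} [Category.{v} C]

/-- An object of the category of elements of a presheaf `F` on `C`: an object `T` of `C` together
with an element of `F(T)`. -/
structure El (F : Cᵒᵖ ⥤ Type w) where
  base : C
  elt : F.obj (op base)

/-- A morphism `(T', a') ⟶ (T, a)` is a morphism `f : T' ⟶ T` with `f^* a = a'`. -/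
instance (F : Cᵒᵖ ⥤ Type w) : Category.{v} (El F) where
  Hom x y := {f : x.base ⟶ y.base // F.map f.op y.elt = x.elt}
  id x := ⟨𝟙 x.base, by simp⟩
  comp f g := ⟨f.1 ≫ g.1, by simp [f.2, g.2]⟩

/-- The category fibred in sets over `C` associated with a presheaf
(the Grothendieck construction). -/
abbrev el (F : Cᵒᵖ ⥤ Type w) : BasedCategory.{v, max u w} C where
  obj := El F
  p :=
    { obj := fun x : El F => x.base
      map := fun {x y : El F} (f : x ⟶ y) => Subtype.val f }

/-- The functor over `C` associated with a morphism of presheaves. -/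
def elMap {F G : Cᵒᵖ ⥤ Type w} (α : F ⟶ G) : el F ⟶ el G where
  obj x := ⟨x.base, α.app (op x.base) x.elt⟩
  map {x y} f := ⟨f.1, by
    have h := ConcreteCategory.congr_hom (α.naturality f.1.op) y.elt
    simp only [CategoryTheory.comp_apply] at h
    rw [← h, f.2]⟩
  w := rfl

/-- Categories fibred in groupoids over `C`: arrows of `C` lift with given target, and every arrow
is strongly cartesian. -/
def IsFibredInGroupoids (𝒳 : BasedCategory.{v, w} C) : Prop :=
  (∀ (x : 𝒳.obj) {V : C} (f : V ⟶ 𝒳.p.obj x), ∃ (y : 𝒳.obj) (φ : y ⟶ x), 𝒳.p.IsHomLift f φ) ∧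
    ∀ {x y : 𝒳.obj} (φ : y ⟶ x), 𝒳.p.IsStronglyCartesian (𝒳.p.map φ) φ

/-- Stacks in groupoids over the site `(C, J)`: categories fibred in groupoids such that for every
covering sieve `S` of an object `T`, restriction from `C/T` to `S` is an equivalence of categories
`Hom_C(C/T, 𝒳) ⥤ Hom_C(S, 𝒳)`. (An object of `Hom_C(S, 𝒳)` is a descent datum along `S`, so
full faithfulness says that morphisms glue and essential surjectivity that descent data are
effective.) -/
def IsStackInGroupoids (J : GrothendieckTopology C)
    (𝒳 : BasedCategory.{v, max u v} C) : Prop :=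
  IsFibredInGroupoids 𝒳 ∧
    ∀ (T : C) (S : Sieve T), S ∈ J T →
      (Bicategory.precomp 𝒳 (elMap S.functorInclusion)).IsEquivalence

end Stacks

/-! ## Formal submetries and naive metric stacks -/

/-- The stack over `TBMet` represented by a metric space. -/
abbrev metStack (X : Met.{u}) : BasedCategory.{u, u + 1} TBMet.{u} := el (hMet.obj X)

/-- The morphism of stacks represented by a 1-Lipschitz map. -/
abbrev metStackMap {X Y : Met.{u}} (f : X ⟶ Y) : metStack X ⟶ metStack Y := elMap (hMet.map f)

/-- A formal submetry `f : 𝒳 ⟶ 𝒴`.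

First, `f_* : 𝒳(*) ⥤ 𝒴(*)` is essentially surjective, where `𝒳(*) = Hom(*, 𝒳)`. Second, for
`r > s > 0`, for `x : * ⟶ 𝒳` and `g : 2_s ⟶ 𝒴`, and for every 2-isomorphism
`α : f ∘ x ≅ g ∘ ι_{0s}`, there are `h : 2_r ⟶ 𝒳` and 2-isomorphisms `β : h ∘ ι_{0r} ≅ x` and
`γ : f ∘ h ≅ g ∘ ι_{rs}` with `α ∘ (f ⋆ β) = γ ⋆ ι_{0r}`.
Here `ι_{0s}` is written as the composite `ι_{rs} ∘ ι_{0r}`. -/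
def IsFormalSubmetry {𝒳 𝒴 : BasedCategory.{u, u + 1} TBMet.{u}} (f : 𝒳 ⟶ 𝒴) : Prop :=
  (Bicategory.postcomp (metStack pt.{u}) f).EssSurj ∧
    ∀ (r s : ℝ) (hs : 0 < s) (hr : s < r)
      (x : metStack pt.{u} ⟶ 𝒳) (g : metStack (two.{u} s) ⟶ 𝒴)
      (α : x ≫ f ≅
        (metStackMap (iotaZero.{u} r) ≫ metStackMap (iota.{u} hs hr)) ≫ g),
      ∃ (h : metStack (two.{u} r) ⟶ 𝒳)
        (β : metStackMap (iotaZero.{u} r) ≫ h ≅ x)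
        (γ : h ≫ f ≅ metStackMap (iota.{u} hs hr) ≫ g),
        β.hom ▷ f ≫ α.hom =
          (α_ (metStackMap (iotaZero.{u} r)) h f).hom ≫
            metStackMap (iotaZero.{u} r) ◁ γ.hom ≫
              (α_ (metStackMap (iotaZero.{u} r)) (metStackMap (iota.{u} hs hr)) g).inv

/-- A naive metric stack: a stack in groupoids over `TBMet` with the lsm topology that admits a
formal submetry from a metric space. -/
def IsNaiveMetricStack (𝒳 : BasedCategory.{u, u + 1} TBMet.{u}) : Prop :=
  IsStackInGroupoids lsm 𝒳 ∧ ∃ (X : Met.{u}) (f : metStack X ⟶ 𝒳), IsFormalSubmetry f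

/-! ## The moduli stack of compact metric spaces -/

/-- A family of metric spaces: a 1-Lipschitz map to a totally bounded metric space. -/
structure AllMet : Type (u + 1) where
  base : TBMet.{u}
  total : Met.{u}
  proj : total ⟶ TBMet.incl.obj base

/-- A morphism of families is a cartesian square in `Met`. -/
@[ext]
structure AllMet.Hom (P Q : AllMet.{u}) : Type u where
  onBase : P.base ⟶ Q.base
  onTotal : P.total ⟶ Q.total
  isPullback : IsPullback onTotal P.proj Q.proj (TBMet.incl.map onBase)

instance : Category.{u} AllMet.{u} where
  Hom P Q := AllMet.Hom P Q
  id P := ⟨𝟙 P.base, 𝟙 P.total, IsPullback.of_id_fst (f := P.proj)⟩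
  comp f g := ⟨f.onBase ≫ g.onBase, f.onTotal ≫ g.onTotal,
    f.isPullback.paste_horiz g.isPullback⟩

/-- The functor sending a family to its base. -/
abbrev AllMet.cod : AllMet.{u} ⥤ TBMet.{u} where
  obj P := P.base
  map f := AllMet.Hom.onBase f

/-- The families of compact metric spaces: the proper submetries. -/
def isGH : ObjectProperty AllMet.{u} := fun P => IsProperSubmetry P.proj

/-- The stack `GH`: the full subcategory of `AllMet` of the proper submetries, over `TBMet`. -/
abbrev GH : BasedCategory.{u, u + 1} TBMet.{u} where
  obj := isGH.{u}.FullSubcategory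
  p := isGH.ι ⋙ AllMet.cod

/-! ## Families of compact subsets and the Urysohn chart -/

/-- The metric space `Cpt(X)` of non-empty compact subsets of `X` with the Hausdorff distance. -/
abbrev Cpt (X : Met.{u}) : Met.{u} := ⟨NonemptyCompacts X⟩

/-- A point of `Cpt(X)` as a subset of `X`. -/
def Cpt.toSet {X : Met.{u}} (K : Cpt X) : Set X := (NonemptyCompacts.toCompacts K).carrier

/-- The value at `t` of a `T`-valued point of the presheaf represented by `X`. -/
def evalAt {X : Met.{u}} {T : TBMet.{u}} (f : (hMet.obj X).obj (op T)) (t : T.toMet) : X :=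
  Met.Hom.toFun f t

/-- The projection `A ⟶ T` of a subset `A` of `X × T`; the product has the maximum distance. -/
def projSubset {X T : Met.{u}} (A : Set (X × T)) : (⟨A⟩ : Met.{u}) ⟶ T :=
  Met.Hom.mk (fun a => a.1.2) (fun _ _ => le_max_right _ _)

/-- The base change of a subset of `X × T` along `T' ⟶ T`. -/
def pullSubset {X T T' : Met.{u}} (h : T' ⟶ T) (A : Set (X × T)) : Set (X × T') :=
  {z | (z.1, h z.2) ∈ A}

/-- The map `(x, t') ↦ (x, h(t'))` from the base change `A'` of `A ⊆ X × T` to `A`. -/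
def pullSubsetMap {X T T' : Met.{u}} (h : T' ⟶ T) (A : Set (X × T)) (A' : Set (X × T'))
    (e : pullSubset h A = A') : (⟨A'⟩ : Met.{u}) ⟶ (⟨A⟩ : Met.{u}) :=
  Met.Hom.mk (fun a => ⟨(a.1.1, h a.1.2), (Set.ext_iff.1 e a.1).2 a.2⟩)
    (fun a a' => max_le_max le_rfl (Met.Hom.dist_le h a.1.2 a'.1.2))

theorem isPullback_pullSubsetMap {X T T' : Met.{u}} (h : T' ⟶ T) (A : Set (X × T))
    (A' : Set (X × T')) (e : pullSubset h A = A') :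
    IsPullback (pullSubsetMap h A A' e) (projSubset A') (projSubset A) h := by
  subst e
  refine ⟨⟨rfl⟩, ⟨Limits.PullbackCone.IsLimit.mk _ (fun c => ?_) (fun c => ?_) (fun c => ?_) ?_⟩⟩
  · refine Met.Hom.mk (fun z => ⟨((c.fst z).1.1, c.snd z), ?_⟩) (fun z z' => ?_)
    · have e : (c.fst z).1.2 = h (c.snd z) := DFunLike.congr_fun c.condition z
      change ((c.fst z).1.1, h (c.snd z)) ∈ A
      rw [← e]
      exact (c.fst z).2
    · exact max_le ((le_max_left _ _).trans (Met.Hom.dist_le c.fst z z'))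
        (Met.Hom.dist_le c.snd z z')
  · refine Met.hom_ext fun z => Subtype.ext (Prod.ext rfl ?_)
    exact (DFunLike.congr_fun c.condition z).symm
  · rfl
  · intro c m h1 h2
    refine Met.hom_ext fun z => Subtype.ext (Prod.ext ?_ ?_)
    · exact congrArg (fun a => a.1.1) (DFunLike.congr_fun h1 z)
    · exact DFunLike.congr_fun h2 z

theorem isProperSubmetry_pullSubset {X T T' : Met.{u}} (h : T' ⟶ T) {A : Set (X × T)}
    (hA : IsProperSubmetry (projSubset A)) :
    IsProperSubmetry (projSubset (pullSubset h A)) := by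
  obtain ⟨⟨hs, hd⟩, hp⟩ := hA
  have key : ∀ b₀ b₁ : T', ∀ a ∈ projSubset (pullSubset h A) ⁻¹' {b₀},
      Metric.infEDist a (projSubset (pullSubset h A) ⁻¹' {b₁}) ≤ edist b₀ b₁ := by
    rintro b₀ b₁ ⟨⟨x, t⟩, ha⟩ rfl
    change Metric.infEDist _ _ ≤ edist t b₁
    refine le_of_forall_gt fun c hc => ?_
    have h1 : Metric.infEDist (⟨(x, h t), ha⟩ : A) (projSubset A ⁻¹' {h b₁}) < c := by
      refine (Metric.infEDist_le_hausdorffEDist_of_mem (s := projSubset A ⁻¹' {h t}) rfl).trans_lt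
        (((hd _ _).trans ?_).trans_lt hc)
      rw [edist_dist, edist_dist]
      exact ENNReal.ofReal_le_ofReal (Met.Hom.dist_le h t b₁)
    obtain ⟨⟨⟨y, t'⟩, hy⟩, hy', hlt⟩ := Metric.infEDist_lt_iff.1 h1
    obtain rfl : t' = h b₁ := hy'
    refine Metric.infEDist_lt_iff.2 ⟨⟨(y, b₁), hy⟩, rfl, ?_⟩
    exact max_lt ((le_max_left _ _).trans_lt hlt) hc
  refine ⟨⟨fun t => ?_, fun b₀ b₁ => ?_⟩, ?_⟩
  · obtain ⟨⟨⟨x, t'⟩, hx⟩, e⟩ := hs (h t)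
    obtain rfl : t' = h t := e
    exact ⟨⟨(x, t), hx⟩, rfl⟩
  · refine Metric.hausdorffEDist_le_of_infEDist (key b₀ b₁) fun a ha => ?_
    rw [edist_comm]
    exact key b₁ b₀ a ha
  · have lip : ∀ {Y Z : Met.{u}} (g : Y ⟶ Z), Continuous g := fun g =>
      (LipschitzWith.of_dist_le_mul (K := 1) (fun a b => by
        rw [NNReal.coe_one, one_mul]; exact Met.Hom.dist_le g a b)).continuous
    rw [isProperMap_iff_ultrafilter] at hp ⊢
    refine ⟨lip _, fun 𝒰 y hy => ?_⟩
    have h1 : Filter.Tendsto (projSubset A)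
        (𝒰.map (pullSubsetMap h A _ rfl) : Ultrafilter _) (nhds (h y)) :=
      Filter.tendsto_map'_iff.2 (((lip h).tendsto y).comp hy)
    obtain ⟨⟨⟨x, t⟩, hx⟩, e, hlim⟩ := hp.2 h1
    obtain rfl : t = h y := e
    refine ⟨⟨(x, y), hx⟩, rfl, ?_⟩
    have h2 : Filter.Tendsto (fun a : (⟨pullSubset h A⟩ : Met.{u}) => a.1.1) 𝒰 (nhds x) :=
      ((continuous_fst.comp continuous_subtype_val).tendsto
        (⟨(x, h y), hx⟩ : A)).comp (f := pullSubsetMap h A _ rfl) hlim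
    have h3 : Filter.Tendsto (Subtype.val : pullSubset h A → X × T') 𝒰 (nhds (x, y)) :=
      h2.prodMk_nhds hy
    exact tendsto_subtype_rng.2 h3

/-- The presheaf on `TBMet` sending `T` to the set of the subsets `A` of `X × T` whose projection
`A ⟶ T` is a proper submetry. -/
def inCpt (X : Met.{u}) : TBMet.{u}ᵒᵖ ⥤ Type u where
  obj T := {A : Set (X × T.unop.toMet) // IsProperSubmetry (projSubset A)}
  map h := ↾fun A => ⟨pullSubset (TBMet.incl.map h.unop) A.1, isProperSubmetry_pullSubset _ A.2⟩

/-- The morphism `p : inCpt(X) ⟶ GH` over `TBMet`, sending `A ⊆ X × T` to the family `A ⟶ T`, and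
an arrow over `h : T' ⟶ T` from `A' = h^* A` to `A` to the cartesian square formed by
`(x, t') ↦ (x, h(t'))` and `h`. -/
def subsetFamily (X : Met.{u}) : el (inCpt X) ⟶ GH.{u} where
  obj a := ⟨⟨a.base, ⟨a.elt.1⟩, projSubset a.elt.1⟩, a.elt.2⟩
  map {a' a} h := ⟨⟨h.1, pullSubsetMap (TBMet.incl.map h.1) a.elt.1 a'.elt.1
    (congrArg Subtype.val h.2), isPullback_pullSubsetMap _ _ _ _⟩⟩
  w := rfl

/-- The Urysohn universal space: a separable complete metric space such that isometric embeddings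
of finite metric spaces extend along isometric embeddings of finite metric spaces. -/
def IsUrysohn (U : Met.{u}) : Prop :=
  SeparableSpace U ∧ CompleteSpace U ∧
    ∀ (A X : Type u) [MetricSpace A] [MetricSpace X] [Finite A] [Finite X]
      (i : A → X) (f : A → U), Isometry i → Isometry f →
        ∃ g : X → U, Isometry g ∧ g ∘ i = f

end

end MetricStacks

open MetricStacks

namespace MetricStacks

noncomputable section

/-! ### Descent data and cocones in categories fibred in groupoids -/

section Glueing

variable {C : Type u} [Category.{v} C] {𝒳 : BasedCategory.{v, max u v} C}

/-! Descent. The slice category over `T` has a terminal object, so a functor over the base category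
from it to a category fibred in groupoids amounts to its value at the identity of `T`. The stack
condition for a sieve thus says that every descent datum has a cocone over the structure maps to `T`
(`IsGlueing`), unique up to unique isomorphism (`isStackInGroupoids_of_isGlueing`).

For `GH`, cartesian squares carry the maximum metric, so the distance in a base-changed family is
the larger of the distance in the original total space and the distance in the new base. Every point
of `T` lies in a covering sieve, so a descent datum has fibres over the points of `T`, and the glued
space is their union. The distance of two of its points is the infimum over the members of the datum
in which both are represented. Comparing two members over a common two-point space
(`Rel.dist_eq_max`) shows that passing to another member can raise a distance only up to the
distance in the base. Hence each member is a base change of the glued space (`Rel.dist_eq`), and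
almost isometric lifting of triples gives the triangle inequality. Lifting of pairs gives the sheaf
property of the presheaf represented by a metric space, and a family of compact subsets is the same
as the map to `Cpt` given by its slices.

The chart. A proper submetry to a finite space has compact total space `P`, and an isometric
embedding of `P` into `U` turns the family into a family of compact subsets of `U`. Lifting along
the chart therefore means extending an isometric embedding of one fibre to all of `P`
(`exists_chart_extend`). For this, the finite extension property is upgraded to compact spaces: a
Katětov function on a totally bounded set is realized approximately, the realizing point is
corrected by ever smaller steps, and completeness gives an exact realization
(`HasApproxExtension.exists_dist_eq`). Adding a dense sequence of points one at a time then extends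
the embedding.

Existence of `U` is a Baire category argument: in the Polish space of pseudometrics on `ℕ`, a
generic one realizes all rational Katětov data approximately, and its completion is a Urysohn space.
-/

theorem IsFibredInGroupoids.isStronglyCartesian (h𝒳 : IsFibredInGroupoids 𝒳) {R S : C}
    {a b : 𝒳.obj} (f : R ⟶ S) (φ : a ⟶ b) (h : 𝒳.p.IsHomLift f φ) :
    𝒳.p.IsStronglyCartesian f φ := by
  subst_hom_lift 𝒳.p f φ
  exact h𝒳.2 φ

theorem IsFibredInGroupoids.exists_isHomLift (h𝒳 : IsFibredInGroupoids 𝒳) {x : 𝒳.obj} {V T : C}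
    (hx : 𝒳.p.obj x = T) (f : V ⟶ T) : ∃ (y : 𝒳.obj) (φ : y ⟶ x), 𝒳.p.IsHomLift f φ := by
  subst hx
  exact h𝒳.1 x f

theorem IsFibredInGroupoids.hom_ext (h𝒳 : IsFibredInGroupoids 𝒳) {R S W : C}
    {a b d : 𝒳.obj} {f : R ⟶ S} {g : W ⟶ R} {φ : a ⟶ b} {ψ ψ' : d ⟶ a}
    (h : 𝒳.p.IsHomLift f φ) (hψ : 𝒳.p.IsHomLift g ψ) (hψ' : 𝒳.p.IsHomLift g ψ')
    (e : ψ ≫ φ = ψ' ≫ φ) : ψ = ψ' :=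
  have := h𝒳.isStronglyCartesian f φ h
  Functor.IsStronglyCartesian.ext 𝒳.p f φ g e

theorem IsFibredInGroupoids.exists_hom (h𝒳 : IsFibredInGroupoids 𝒳) {R S W : C}
    {a b d : 𝒳.obj} {f : R ⟶ S} (g : W ⟶ R) {k : W ⟶ S} (e : k = g ≫ f) {φ : a ⟶ b} {ψ : d ⟶ b}
    (h : 𝒳.p.IsHomLift f φ) (hψ : 𝒳.p.IsHomLift k ψ) :
    ∃ χ : d ⟶ a, 𝒳.p.IsHomLift g χ ∧ χ ≫ φ = ψ :=
  have := h𝒳.isStronglyCartesian f φ h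
  (Functor.IsStronglyCartesian.universal_property 𝒳.p f φ g k e ψ).exists

theorem IsFibredInGroupoids.isIso (h𝒳 : IsFibredInGroupoids 𝒳) {R : C}
    {a b : 𝒳.obj} {φ : a ⟶ b} (h : 𝒳.p.IsHomLift (𝟙 R) φ) : IsIso φ :=
  have := h𝒳.isStronglyCartesian (𝟙 R) φ h
  Functor.IsStronglyCartesian.isIso_of_base_isIso 𝒳.p (𝟙 R) φ

variable {F : Cᵒᵖ ⥤ Type v}

theorem isHomLift_el_map (D : el F ⥤ᵇ 𝒳) {x y : El F} (h : x ⟶ y) :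
    𝒳.p.IsHomLift h.1 (D.map h) :=
  have : (el F).p.IsHomLift h.1 h := Functor.IsHomLift.map (p := (el F).p) h
  D.preserves_isHomLift h.1 h

/-- A cocone `c` with vertex `a` under `D : el F ⟶ 𝒳` lying over a cocone `q` with vertex `T` under
`el F ⥤ C`. -/
structure IsGlueing (D : el F ⥤ᵇ 𝒳) {T : C} (q : ∀ x : El F, x.base ⟶ T) (a : 𝒳.obj)
    (c : ∀ x, D.obj x ⟶ a) : Prop where
  base : 𝒳.p.obj a = T
  lift : ∀ x, 𝒳.p.IsHomLift (q x) (c x)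
  w : ∀ {x y : El F} (h : x ⟶ y), D.map h ≫ c y = c x

/-- Choose a lift of every `q x` with target `a`. Since the lifts are cartesian, the comparison
arrows between them are unique, hence functorial. -/
theorem IsFibredInGroupoids.exists_isGlueing (h𝒳 : IsFibredInGroupoids 𝒳) {T : C}
    (q : ∀ x : El F, x.base ⟶ T) (hq : ∀ {x y : El F} (h : x ⟶ y), h.1 ≫ q y = q x)
    {a : 𝒳.obj} (ha : 𝒳.p.obj a = T) :
    ∃ (D : el F ⥤ᵇ 𝒳) (c : ∀ x, D.obj x ⟶ a), IsGlueing D q a c := by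
  choose y c hc using fun x => h𝒳.exists_isHomLift ha (q x)
  choose m hm hmc using fun {x x' : El F} (h : x ⟶ x') =>
    h𝒳.exists_hom h.1 (hq h).symm (hc x') (hc x)
  have hy : ∀ x, 𝒳.p.obj (y x) = x.base := fun x =>
    have := hc x
    IsHomLift.domain_eq 𝒳.p (q x) (c x)
  refine ⟨{ obj := y, map := m, map_id := fun x => ?_, map_comp := fun {x x' x''} h h' => ?_,
            w := ?_ }, c, ha, hc, fun h => hmc h⟩
  · exact h𝒳.hom_ext (hc x) (hm (𝟙 x)) (IsHomLift.id (hy x)) (by rw [hmc, Category.id_comp])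
  · have := hm h
    have := hm h'
    exact h𝒳.hom_ext (hc x'') (hm (h ≫ h')) (IsHomLift.comp 𝒳.p h.1 h'.1 (m h) (m h'))
      (by rw [hmc, Category.assoc, hmc, hmc])
  · refine CategoryTheory.Functor.ext hy fun x x' h => ?_
    have := hm h
    exact IsHomLift.fac' 𝒳.p h.1 (m h)

theorem IsGlueing.restrict {G : Cᵒᵖ ⥤ Type v} {D : el G ⥤ᵇ 𝒳} {T : C}
    {q : ∀ x : El G, x.base ⟶ T} {a : 𝒳.obj} {c : ∀ x, D.obj x ⟶ a} (hc : IsGlueing D q a c)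
    (α : F ⟶ G) :
    IsGlueing (BasedFunctor.comp (elMap α) D) (fun x => q ((elMap α).obj x)) a
      (fun x => c ((elMap α).obj x)) :=
  ⟨hc.base, fun _ => hc.lift _, fun h => hc.w ((elMap α).map h)⟩

theorem isGlueing_of_isTerminal (D : el F ⥤ᵇ 𝒳) {x₀ : El F} (h₀ : Limits.IsTerminal x₀) :
    IsGlueing D (fun x => (h₀.from x).1) (D.obj x₀) (fun x => D.map (h₀.from x)) :=
  ⟨D.w_obj x₀, fun _ => isHomLift_el_map D _, fun h => by
    rw [← D.map_comp, h₀.hom_ext (h ≫ h₀.from _) (h₀.from _)]⟩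

theorem IsGlueing.comp_natTrans {D D' : el F ⥤ᵇ 𝒳} {T : C} {q : ∀ x : El F, x.base ⟶ T}
    {a : 𝒳.obj} {c : ∀ x, D.obj x ⟶ a} (hc : IsGlueing D q a c) (τ : D' ⟶ D) :
    IsGlueing D' q a (fun x => τ.toNatTrans.app x ≫ c x) := by
  refine ⟨hc.base, fun x => ?_, fun h => ?_⟩
  · have := hc.lift x
    have : 𝒳.p.IsHomLift (𝟙 x.base) (τ.toNatTrans.app x) := τ.isHomLift' x
    infer_instance
  · rw [← Category.assoc, τ.toNatTrans.naturality, Category.assoc, hc.w]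

/-- The arrows `c' x` are cartesian, so each `c x ≫ σ` factors through `c' x` over the identity.
Uniqueness of the factorization gives naturality. -/
theorem IsGlueing.exists_natTrans (h𝒳 : IsFibredInGroupoids 𝒳) {D D' : el F ⥤ᵇ 𝒳} {T : C}
    {q : ∀ x : El F, x.base ⟶ T} {a b : 𝒳.obj} {c : ∀ x, D.obj x ⟶ a} {c' : ∀ x, D'.obj x ⟶ b}
    (hc : IsGlueing D q a c) (hc' : IsGlueing D' q b c') {σ : a ⟶ b}
    (hσ : 𝒳.p.IsHomLift (𝟙 T) σ) :
    ∃ τ : D ⟶ D', ∀ x, τ.toNatTrans.app x ≫ c' x = c x ≫ σ := by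
  have hcσ : ∀ x, 𝒳.p.IsHomLift (q x) (c x ≫ σ) := fun x => by
    have := hc.lift x
    infer_instance
  choose t ht htc using fun x => h𝒳.exists_hom (𝟙 x.base) (Category.id_comp _).symm
    (hc'.lift x) (hcσ x)
  refine ⟨{ app := t, naturality := fun x y h => ?_, isHomLift' := ht }, htc⟩
  have := isHomLift_el_map D h
  have := isHomLift_el_map D' h
  have := ht x
  have := ht y
  exact h𝒳.hom_ext (g := h.1) (hc'.lift y) inferInstance inferInstance (by
    rw [Category.assoc, htc, ← Category.assoc, hc.w, Category.assoc, hc'.w, htc])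

theorem IsGlueing.natTrans_ext (h𝒳 : IsFibredInGroupoids 𝒳) {D D' : el F ⥤ᵇ 𝒳} {T : C}
    {q : ∀ x : El F, x.base ⟶ T} {b : 𝒳.obj} {c' : ∀ x, D'.obj x ⟶ b}
    (hc' : IsGlueing D' q b c') {τ τ' : D ⟶ D'}
    (h : ∀ x, τ.toNatTrans.app x ≫ c' x = τ'.toNatTrans.app x ≫ c' x) : τ = τ' := by
  refine BasedNatTrans.homCategory.ext _ _ (NatTrans.ext (funext fun x => ?_))
  exact h𝒳.hom_ext (hc'.lift x) (τ.isHomLift' x) (τ'.isHomLift' x) (h x)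

theorem IsFibredInGroupoids.isIso_natTrans (h𝒳 : IsFibredInGroupoids 𝒳) {D D' : el F ⥤ᵇ 𝒳}
    (τ : D ⟶ D') : IsIso τ := by
  have : ∀ x, IsIso (τ.toNatTrans.app x) := fun x => h𝒳.isIso (τ.isHomLift' x)
  have : IsIso (C := (el F).obj ⥤ 𝒳.obj) τ.toNatTrans := NatIso.isIso_of_isIso_app _
  exact BasedNatIso.isIso_of_toNatTrans_isIso τ

/-- The object `(T, 𝟙)` is terminal in the category of elements of the presheaf represented
by `T`. -/
def isTerminalElYoneda (T : C) : Limits.IsTerminal (⟨T, 𝟙 T⟩ : El (yoneda.obj T)) :=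
  Limits.IsTerminal.ofUniqueHom (fun x => ⟨x.elt, Category.comp_id _⟩) fun x m =>
    Subtype.ext (by have := m.2; simpa using this)

/-- A functor on the slice over `T` restricts to a descent datum glued to its value at the identity
of `T`. Thus `hE` gives essential surjectivity, while existence and uniqueness in `hU` give fullness
and faithfulness. -/
theorem isStackInGroupoids_of_isGlueing {J : GrothendieckTopology C} (h𝒳 : IsFibredInGroupoids 𝒳)
    (hE : ∀ (T : C) (S : Sieve T), S ∈ J T → ∀ D : el S.functor ⥤ᵇ 𝒳,
      ∃ (a : 𝒳.obj) (c : ∀ x, D.obj x ⟶ a), IsGlueing D (fun x => x.elt.1) a c)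
    (hU : ∀ (T : C) (S : Sieve T), S ∈ J T → ∀ (D : el S.functor ⥤ᵇ 𝒳) (a b : 𝒳.obj)
      (c : ∀ x, D.obj x ⟶ a) (c' : ∀ x, D.obj x ⟶ b), IsGlueing D (fun x => x.elt.1) a c →
      IsGlueing D (fun x => x.elt.1) b c' →
      ∃! σ : a ⟶ b, 𝒳.p.IsHomLift (𝟙 T) σ ∧ ∀ x, c x ≫ σ = c' x) :
    IsStackInGroupoids J 𝒳 := by
  refine ⟨h𝒳, fun T S hS => ?_⟩
  have h₀ := isTerminalElYoneda T
  have hf : ∀ x : El (yoneda.obj T), (h₀.from x).1 = x.elt := fun x =>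
    congrArg Subtype.val (h₀.hom_ext (h₀.from x) ((isTerminalElYoneda T).from x))
  have top : ∀ G : el (yoneda.obj T) ⥤ᵇ 𝒳, IsGlueing G (fun x => x.elt) (G.obj ⟨T, 𝟙 T⟩)
      (fun x => G.map (h₀.from x)) := fun G => by
    have := isGlueing_of_isTerminal G h₀
    simp only [hf] at this
    exact this
  have faith : ∀ (G G' : el (yoneda.obj T) ⥤ᵇ 𝒳) (τ τ' : G ⟶ G'),
      BasedCategory.whiskerLeft (elMap S.functorInclusion) τ =
        BasedCategory.whiskerLeft (elMap S.functorInclusion) τ' → τ = τ' := by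
    intro G G' τ τ' e
    have e1 : ∀ x : El S.functor, τ.toNatTrans.app ((elMap S.functorInclusion).obj x) =
        τ'.toNatTrans.app ((elMap S.functorInclusion).obj x) := fun x =>
      congrArg (fun t => t.toNatTrans.app x) e
    have e0 : τ.toNatTrans.app ⟨T, 𝟙 T⟩ = τ'.toNatTrans.app ⟨T, 𝟙 T⟩ := by
      have r := (top G).restrict S.functorInclusion
      -- Both components at the identity of `T` compare the cocone of `G` with that of `G'`
      -- precomposed with the common restriction, so `hU` identifies them.
      have r' : IsGlueing _ _ _ _ := ((top G').restrict S.functorInclusion).comp_natTrans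
        (BasedCategory.whiskerLeft (elMap S.functorInclusion) τ)
      refine (hU T S hS _ _ _ _ _ r r').unique ⟨τ.isHomLift' ⟨T, 𝟙 T⟩, fun x => ?_⟩
        ⟨τ'.isHomLift' ⟨T, 𝟙 T⟩, fun x => ?_⟩
      · exact τ.toNatTrans.naturality _
      · refine (τ'.toNatTrans.naturality _).trans ?_
        rw [← e1]
        rfl
    refine (top G').natTrans_ext h𝒳 fun x => ?_
    rw [← τ.toNatTrans.naturality, ← τ'.toNatTrans.naturality, e0]
  have full : ∀ (G G' : el (yoneda.obj T) ⥤ᵇ 𝒳)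
      (t : BasedFunctor.comp (elMap S.functorInclusion) G ⟶
        BasedFunctor.comp (elMap S.functorInclusion) G'),
      ∃ τ : G ⟶ G', BasedCategory.whiskerLeft (elMap S.functorInclusion) τ = t := by
    intro G G' t
    have r := (top G).restrict S.functorInclusion
    have r' := (top G').restrict S.functorInclusion
    obtain ⟨σ, ⟨hσ, hσ'⟩, -⟩ := hU T S hS _ _ _ _ _ r
      (r'.comp_natTrans t)
    obtain ⟨τ, hτ⟩ := (top G).exists_natTrans h𝒳 (top G') hσ
    refine ⟨τ, r'.natTrans_ext h𝒳 fun x => ?_⟩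
    exact (hτ _).trans (hσ' x)
  have ess : ∀ D : el S.functor ⥤ᵇ 𝒳, ∃ G : el (yoneda.obj T) ⥤ᵇ 𝒳,
      Nonempty (BasedFunctor.comp (elMap S.functorInclusion) G ≅ D) := by
    intro D
    obtain ⟨a, c, hc⟩ := hE T S hS D
    obtain ⟨G, d, hd⟩ := h𝒳.exists_isGlueing (F := yoneda.obj T) (fun x => x.elt)
      (fun {x y} h => h.2) hc.base
    obtain ⟨τ, -⟩ := (hd.restrict S.functorInclusion).exists_natTrans h𝒳 hc
      (IsHomLift.id hc.base)
    have := h𝒳.isIso_natTrans τ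
    exact ⟨G, ⟨asIso τ⟩⟩
  exact
    { faithful := ⟨fun {G G'} τ τ' e => faith G G' τ τ' e⟩
      full := ⟨fun {G G'} t => full G G' t⟩
      essSurj := ⟨fun D => ess D⟩ }

end Glueing

/-! ### Cartesian squares of metric spaces and proper submetries -/

section MetPullback

variable {P Q V T : Met.{u}} {φ : P ⟶ Q} {p : P ⟶ V} {q : Q ⟶ T} {f : V ⟶ T}

theorem Met.dist_map_le (f : V ⟶ T) (x y : V) : dist (f x) (f y) ≤ dist x y :=
  Met.Hom.dist_le f x y

theorem Met.continuous (f : V ⟶ T) : Continuous f :=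
  (LipschitzWith.of_dist_le_mul (K := 1) (fun a b => by
    rw [NNReal.coe_one, one_mul]; exact Met.dist_map_le f a b)).continuous

/-- The bound `hd` makes the pair `(φ, p)` injective and its set-theoretic lifts 1-Lipschitz. With
`he` this identifies `P` with the fibre product in the maximum metric. -/
theorem Met.isPullback_of_dist (w : ∀ x, q (φ x) = f (p x))
    (hd : ∀ x y, dist x y ≤ max (dist (φ x) (φ y)) (dist (p x) (p y)))
    (he : ∀ a v, q a = f v → ∃ x, φ x = a ∧ p x = v) : IsPullback φ p q f := by
  refine ⟨⟨Met.hom_ext w⟩, ⟨Limits.PullbackCone.IsLimit.mk _ (fun c => ?_) (fun c => ?_)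
    (fun c => ?_) ?_⟩⟩
  · choose l h1 h2 using fun z => he (c.fst z) (c.snd z) (DFunLike.congr_fun c.condition z)
    exact Met.Hom.mk l fun z z' => (hd _ _).trans (max_le
      (by rw [h1, h1]; exact Met.dist_map_le c.fst z z')
      (by rw [h2, h2]; exact Met.dist_map_le c.snd z z'))
  · exact Met.hom_ext fun z =>
      (Classical.choose_spec (he (c.fst z) (c.snd z) (DFunLike.congr_fun c.condition z))).1
  · exact Met.hom_ext fun z =>
      (Classical.choose_spec (he (c.fst z) (c.snd z) (DFunLike.congr_fun c.condition z))).2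
  · intro c m h1 h2
    refine Met.hom_ext fun z => ?_
    have h3 := Classical.choose_spec
      (he (c.fst z) (c.snd z) (DFunLike.congr_fun c.condition z))
    refine dist_le_zero.1 ((hd _ _).trans (max_le (dist_le_zero.2 ?_) (dist_le_zero.2 ?_)))
    · exact (DFunLike.congr_fun h1 z).trans h3.1.symm
    · exact (DFunLike.congr_fun h2 z).trans h3.2.symm

/-- The fibre product of metric spaces, with the maximum distance. -/
abbrev Met.fibreProd (q : Q ⟶ T) (f : V ⟶ T) : Met.{u} := ⟨{z : Q × V // q z.1 = f z.2}⟩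

/-- The first projection of the fibre product. -/
def Met.fibreProdFst (q : Q ⟶ T) (f : V ⟶ T) : Met.fibreProd q f ⟶ Q :=
  Met.Hom.mk (fun z => z.1.1) (fun _ _ => le_max_left _ _)

/-- The second projection of the fibre product. -/
def Met.fibreProdSnd (q : Q ⟶ T) (f : V ⟶ T) : Met.fibreProd q f ⟶ V :=
  Met.Hom.mk (fun z => z.1.2) (fun _ _ => le_max_right _ _)

theorem Met.isPullback_fibreProd (q : Q ⟶ T) (f : V ⟶ T) :
    IsPullback (Met.fibreProdFst q f) (Met.fibreProdSnd q f) q f :=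
  Met.isPullback_of_dist (fun x => x.2) (fun _ _ => le_rfl) fun a v e => ⟨⟨(a, v), e⟩, rfl, rfl⟩

theorem Met.lift_of_isPullback (h : IsPullback φ p q f) :
    ∃ l : Met.fibreProd q f ⟶ P, (∀ z, φ (l z) = z.1.1) ∧ (∀ z, p (l z) = z.1.2) ∧
      ∀ x, l ⟨(φ x, p x), DFunLike.congr_fun h.w x⟩ = x := by
  have hw := (Met.isPullback_fibreProd q f).w
  refine ⟨h.lift _ _ hw, fun z => DFunLike.congr_fun (h.lift_fst _ _ hw) z,
    fun z => DFunLike.congr_fun (h.lift_snd _ _ hw) z, fun x => ?_⟩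
  let m : P ⟶ Met.fibreProd q f := Met.Hom.mk (fun x => ⟨(φ x, p x), DFunLike.congr_fun h.w x⟩)
    fun x y => max_le (Met.dist_map_le φ x y) (Met.dist_map_le p x y)
  have : m ≫ h.lift _ _ hw = 𝟙 P := h.hom_ext
    (by rw [Category.assoc, h.lift_fst, Category.id_comp]; rfl)
    (by rw [Category.assoc, h.lift_snd, Category.id_comp]; rfl)
  exact DFunLike.congr_fun this x

theorem Met.dist_of_isPullback (h : IsPullback φ p q f) (x y : P) :
    dist x y = max (dist (φ x) (φ y)) (dist (p x) (p y)) := by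
  obtain ⟨l, -, -, hl⟩ := Met.lift_of_isPullback h
  refine le_antisymm ?_ (max_le (Met.dist_map_le φ x y) (Met.dist_map_le p x y))
  have := Met.dist_map_le l ⟨(φ x, p x), DFunLike.congr_fun h.w x⟩
    ⟨(φ y, p y), DFunLike.congr_fun h.w y⟩
  rwa [hl, hl] at this

theorem Met.exists_of_isPullback (h : IsPullback φ p q f) {a : Q} {v : V} (e : q a = f v) :
    ∃ x, φ x = a ∧ p x = v := by
  obtain ⟨l, h1, h2, -⟩ := Met.lift_of_isPullback h
  exact ⟨l ⟨(a, v), e⟩, h1 _, h2 _⟩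

theorem Met.eq_of_isPullback (h : IsPullback φ p q f) {x y : P} (h1 : φ x = φ y)
    (h2 : p x = p y) : x = y := by
  rw [← dist_eq_zero, Met.dist_of_isPullback h, h1, h2, dist_self, dist_self, max_self]

/-- Compactness of the fibres turns the bound on Hausdorff distances into lifts at no loss of
distance. Conversely such lifts make the map closed, and a continuous closed map with compact fibres
is proper. -/
theorem isProperSubmetry_iff : IsProperSubmetry q ↔ Function.Surjective q ∧
    (∀ t, IsCompact (q ⁻¹' {t})) ∧ ∀ a t, ∃ a', q a' = t ∧ dist a a' ≤ dist (q a) t := by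
  constructor
  · rintro ⟨⟨hs, hd⟩, hp⟩
    have hc : ∀ t, IsCompact (q ⁻¹' {t}) := fun t => hp.isCompact_preimage isCompact_singleton
    refine ⟨hs, hc, fun a t => ?_⟩
    obtain ⟨b, hb⟩ := hs t
    obtain ⟨a', ha', e⟩ := (hc t).exists_infEDist_eq_edist ⟨b, hb⟩ a
    refine ⟨a', ha', ?_⟩
    have : edist a a' ≤ edist (q a) t := by
      rw [← e]
      exact (Metric.infEDist_le_hausdorffEDist_of_mem (s := q ⁻¹' {q a}) rfl).trans (hd _ _)
    rwa [edist_dist, edist_dist, ENNReal.ofReal_le_ofReal_iff dist_nonneg] at this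
  · rintro ⟨hs, hc, hl⟩
    refine ⟨⟨hs, fun t t' => ?_⟩, ?_⟩
    · refine Metric.hausdorffEDist_le_of_mem_edist ?_ ?_
      · rintro a rfl
        obtain ⟨a', h, h'⟩ := hl a t'
        exact ⟨a', h, by rw [edist_dist, edist_dist]; exact ENNReal.ofReal_le_ofReal h'⟩
      · rintro a rfl
        obtain ⟨a', h, h'⟩ := hl a t
        refine ⟨a', h, ?_⟩
        rw [edist_comm t, edist_dist, edist_dist]
        exact ENNReal.ofReal_le_ofReal h'
    · refine isProperMap_iff_isClosedMap_and_compact_fibers.2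
        ⟨Met.continuous q, fun C hC => ?_, fun t => hc t⟩
      -- Move points `x n` of `C` over `b n` to points `y n` in the compact fibre over `t`. As `dist
      -- (x n) (y n)` tends to zero, a limit of a subsequence of `y` is also a limit of points of
      -- `C`.
      refine IsSeqClosed.isClosed fun b t hb ht => ?_
      choose x hx hxb using hb
      choose y hy hxy using fun n => hl (x n) t
      obtain ⟨z, hz, k, hk, hyz⟩ := (hc t).tendsto_subseq (x := y) hy
      refine ⟨z, hC.isSeqClosed (x := x ∘ k) (fun n => hx _) ?_, hz⟩
      refine tendsto_iff_dist_tendsto_zero.2 (squeeze_zero (fun _ => dist_nonneg)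
        (g := fun n => dist (b (k n)) t + dist (y (k n)) z) (fun n => ?_) ?_)
      · refine (dist_triangle _ (y (k n)) _).trans ?_
        gcongr
        rw [← hxb]
        exact hxy _
      · have h1 := (tendsto_iff_dist_tendsto_zero.1 ht).comp hk.tendsto_atTop
        have h2 := tendsto_iff_dist_tendsto_zero.1 hyz
        simpa using h1.add h2

/-- Within one fibre of `p` the base distance vanishes, so `φ` maps the fibre over `v` isometrically
onto the fibre of `q` over `f v`. Lifts of points are found in `Q` and transported through the
square. -/
theorem isProperSubmetry_of_isPullback (h : IsPullback φ p q f) (hq : IsProperSubmetry q) :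
    IsProperSubmetry p := by
  rw [isProperSubmetry_iff] at hq ⊢
  obtain ⟨hs, hc, hl⟩ := hq
  refine ⟨fun v => ?_, fun v => ?_, fun x v => ?_⟩
  · obtain ⟨a, ha⟩ := hs (f v)
    obtain ⟨x, -, hx⟩ := Met.exists_of_isPullback h ha
    exact ⟨x, hx⟩
  · have hi : Isometry fun x : p ⁻¹' {v} => φ x := Isometry.of_dist_eq fun x y => by
      have hx : p x = v := x.2
      have hy : p y = v := y.2
      rw [Subtype.dist_eq, Met.dist_of_isPullback h, hx, hy, dist_self, max_eq_left dist_nonneg]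
    rw [isCompact_iff_isCompact_univ, hi.isUniformInducing.isInducing.isCompact_iff]
    convert hc (f v) using 1
    ext a
    constructor
    · rintro ⟨x, -, rfl⟩
      have hx : p x = v := x.2
      exact (DFunLike.congr_fun h.w x.1).trans (congrArg f hx)
    · intro ha
      obtain ⟨x, hx, hx'⟩ := Met.exists_of_isPullback h (a := a) (v := v) ha
      exact ⟨⟨x, hx'⟩, trivial, hx⟩
  · obtain ⟨a, ha, hd⟩ := hl (φ x) (f v)
    obtain ⟨y, rfl, rfl⟩ := Met.exists_of_isPullback h ha
    refine ⟨y, rfl, ?_⟩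
    rw [Met.dist_of_isPullback h]
    refine max_le (hd.trans ?_) le_rfl
    have : q (φ x) = f (p x) := DFunLike.congr_fun h.w x
    rw [this]
    exact Met.dist_map_le f _ _

end MetPullback

/-! ### Arrows of `GH` as cartesian squares -/

namespace GH

variable {P Q : GH.{u}.obj} {V T : TBMet.{u}}

/-- The projection of a family to a space identified with its base. -/
def projTo (h : GH.{u}.p.obj P = T) : P.obj.total ⟶ T.toMet :=
  P.obj.proj ≫ TBMet.incl.map (eqToHom h)

theorem isProperSubmetry_projTo (h : GH.{u}.p.obj P = T) : IsProperSubmetry (projTo h) := by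
  subst h
  exact P.property

theorem isPullback (hP : GH.{u}.p.obj P = V) (hQ : GH.{u}.p.obj Q = T) {f : V ⟶ T} {φ : P ⟶ Q}
    (h : GH.{u}.p.IsHomLift f φ) :
    IsPullback φ.hom.onTotal (projTo hP) (projTo hQ) (TBMet.incl.map f) := by
  subst hP hQ
  obtain rfl := IsHomLift.eq_of_isHomLift GH.{u}.p f φ
  exact φ.hom.isPullback

theorem exists_hom (hP : GH.{u}.p.obj P = V) (hQ : GH.{u}.p.obj Q = T) {f : V ⟶ T}
    {φ : P.obj.total ⟶ Q.obj.total}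
    (h : IsPullback φ (projTo hP) (projTo hQ) (TBMet.incl.map f)) :
    ∃ ψ : P ⟶ Q, GH.{u}.p.IsHomLift f ψ ∧ ψ.hom.onTotal = φ := by
  subst hP hQ
  exact ⟨⟨⟨f, φ, h⟩⟩, Functor.IsHomLift.map (p := GH.{u}.p) ⟨⟨f, φ, h⟩⟩, rfl⟩

theorem hom_ext {f : V ⟶ T} {φ ψ : P ⟶ Q} (hφ : GH.{u}.p.IsHomLift f φ)
    (hψ : GH.{u}.p.IsHomLift f ψ) (h : ∀ x, φ.hom.onTotal x = ψ.hom.onTotal x) : φ = ψ := by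
  obtain rfl := IsHomLift.domain_eq GH.{u}.p f φ
  obtain rfl := IsHomLift.codomain_eq GH.{u}.p f φ
  obtain rfl := IsHomLift.eq_of_isHomLift GH.{u}.p f φ
  have e := IsHomLift.eq_of_isHomLift GH.{u}.p (GH.{u}.p.map φ) ψ
  exact InducedCategory.hom_ext (AllMet.Hom.ext e (Met.hom_ext h))

/-- Lifts are fibre products, and every arrow is cartesian by the pasting law for cartesian squares.
-/
theorem isFibredInGroupoids : IsFibredInGroupoids GH.{u} := by
  refine ⟨fun P V f => ?_, fun {P Q} φ => ⟨fun {R} g ψ hψ => ?_⟩⟩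
  · have h := Met.isPullback_fibreProd P.obj.proj (TBMet.incl.map f)
    let Q : GH.{u}.obj :=
      ⟨⟨V, _, Met.fibreProdSnd _ _⟩, isProperSubmetry_of_isPullback h P.property⟩
    let φ : Q ⟶ P := ⟨⟨f, _, h⟩⟩
    exact ⟨Q, φ, Functor.IsHomLift.map (p := GH.{u}.p) φ⟩
  · have e := IsHomLift.eq_of_isHomLift GH.{u}.p (g ≫ GH.{u}.p.map φ) ψ
    have h1 : IsPullback ψ.hom.onTotal R.obj.proj P.obj.proj
        (TBMet.incl.map (g ≫ φ.hom.onBase)) := by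
      have := ψ.hom.isPullback
      rwa [show ψ.hom.onBase = g ≫ φ.hom.onBase from e.symm] at this
    rw [Functor.map_comp] at h1
    have h2 := φ.hom.isPullback
    have hw : ψ.hom.onTotal ≫ P.obj.proj =
      (R.obj.proj ≫ TBMet.incl.map g) ≫ TBMet.incl.map φ.hom.onBase := by
      rw [h1.w, Category.assoc]
    have h3 : IsPullback (h2.lift _ _ hw) R.obj.proj Q.obj.proj (TBMet.incl.map g) :=
      IsPullback.of_right (by rw [h2.lift_fst]; exact h1) (h2.lift_snd _ _ hw) h2
    refine ⟨⟨⟨g, _, h3⟩⟩, ⟨Functor.IsHomLift.map (p := GH.{u}.p) ⟨⟨g, _, h3⟩⟩, ?_⟩, ?_⟩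
    · exact InducedCategory.hom_ext (AllMet.Hom.ext e (h2.lift_fst _ _ hw))
    · rintro χ ⟨hχ, rfl⟩
      have e' := IsHomLift.eq_of_isHomLift GH.{u}.p g χ
      subst e'
      refine InducedCategory.hom_ext (AllMet.Hom.ext rfl (h2.hom_ext ?_ ?_))
      · exact (h2.lift_fst _ _ hw).symm
      · exact χ.hom.isPullback.w.trans (h2.lift_snd _ _ hw).symm

end GH

/-! ### Points of covering sieves -/

/-- The one-point space as a totally bounded space. -/
def TBMet.pt : TBMet.{u} := ⟨MetricStacks.pt, Set.finite_univ.totallyBounded⟩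

/-- The map `* ⟶ T` with value `t`. -/
def TBMet.point {T : TBMet.{u}} (t : T.toMet) : TBMet.pt.{u} ⟶ T :=
  Met.Hom.mk (fun _ => t) (fun _ _ => (dist_self _).trans_le dist_nonneg)

theorem TBMet.hom_ext {V T : TBMet.{u}} {f g : V ⟶ T}
    (h : ∀ v, TBMet.incl.map f v = TBMet.incl.map g v) : f = g :=
  Met.hom_ext (X := V.toMet) (Y := T.toMet) h

section Sieve

variable {T : TBMet.{u}} {S : Sieve T}

/-- The structure map to `T` of an object of the category of elements of a sieve on `T`. -/
def loc (x : El S.functor) : x.base.toMet ⟶ T.toMet := TBMet.incl.map x.elt.1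

theorem loc_map {x y : El S.functor} (h : x ⟶ y) (v : x.base.toMet) :
    loc y (TBMet.incl.map h.1 v) = loc x v :=
  DFunLike.congr_fun (F := x.base.toMet ⟶ T.toMet) (congrArg Subtype.val h.2) v

theorem El.exists_hom_sieve {x y : El S.functor} (f : x.base ⟶ y.base)
    (h : ∀ v, loc y (TBMet.incl.map f v) = loc x v) :
    ∃ k : x ⟶ y, k.1 = f :=
  ⟨⟨f, Subtype.ext (TBMet.hom_ext h)⟩, rfl⟩

theorem exists_lift_of_mem_lsm (hS : S ∈ lsm T) (t₁ t₂ t₃ : T.toMet) {δ : ℝ} (hδ : 0 < δ) :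
    ∃ (x : El S.functor) (u₁ u₂ u₃ : x.base.toMet), loc x u₁ = t₁ ∧ loc x u₂ = t₂ ∧
      loc x u₃ = t₃ ∧ dist u₁ u₂ < dist t₁ t₂ + δ ∧ dist u₂ u₃ < dist t₂ t₃ + δ := by
  obtain ⟨I, U, f, ⟨-, h⟩, hf⟩ := hS
  obtain ⟨i, u₁, u₂, u₃, h⟩ := h t₁ t₂ t₃ δ hδ
  exact ⟨⟨U i, ⟨f i, hf i⟩⟩, u₁, u₂, u₃, h⟩

theorem point_mem_of_mem_lsm (hS : S ∈ lsm T) (t : T.toMet) : S (TBMet.point t) := by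
  obtain ⟨x, u, -, -, rfl, -⟩ := exists_lift_of_mem_lsm hS t t t one_pos
  exact S.downward_closed x.elt.2 (TBMet.point u)

/-- The element `t : * ⟶ T` of a covering sieve. -/
def ptEl (hS : S ∈ lsm T) (t : T.toMet) : El S.functor :=
  ⟨TBMet.pt, ⟨TBMet.point t, point_mem_of_mem_lsm hS t⟩⟩

theorem exists_hom_ptEl (hS : S ∈ lsm T) {x : El S.functor} {v : x.base.toMet} {t : T.toMet}
    (h : loc x v = t) : ∃ k : ptEl hS t ⟶ x, k.1 = TBMet.point v :=
  El.exists_hom_sieve (x := ptEl hS t) (TBMet.point v) fun _ => h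

end Sieve

/-! ### Descent for families of compact metric spaces -/

namespace Descent

variable {T : TBMet.{u}} {S : Sieve T} (D : el S.functor ⥤ᵇ GH.{u})

/-- The total space of a member of a descent datum. -/
abbrev tot (x : El S.functor) : Met.{u} := (D.obj x).obj.total

/-- The projection of a member of a descent datum to its base. -/
def pr (x : El S.functor) : tot D x ⟶ x.base.toMet := GH.projTo (D.w_obj x)

/-- The action of a descent datum on total spaces. -/
def mp {x y : El S.functor} (h : x ⟶ y) : tot D x ⟶ tot D y := (D.map h).hom.onTotal

theorem isPullback_mp {x y : El S.functor} (h : x ⟶ y) :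
    IsPullback (mp D h) (pr D x) (pr D y) (TBMet.incl.map h.1) :=
  GH.isPullback _ _ (isHomLift_el_map D h)

theorem mp_comp {x y z : El S.functor} (h : x ⟶ y) (k : y ⟶ z) (p : tot D x) :
    mp D (h ≫ k) p = mp D k (mp D h p) := by
  have : mp D (h ≫ k) = mp D h ≫ mp D k := by
    rw [mp, D.map_comp]
    rfl
  rw [this]
  rfl

theorem pr_mp {x y : El S.functor} (h : x ⟶ y) (p : tot D x) :
    pr D y (mp D h p) = TBMet.incl.map h.1 (pr D x p) :=
  DFunLike.congr_fun (isPullback_mp D h).w p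

theorem isProperSubmetry_pr (x : El S.functor) : IsProperSubmetry (pr D x) :=
  GH.isProperSubmetry_projTo _

theorem mp_ptEl_injective (hS : S ∈ lsm T) {t : T.toMet} {x : El S.functor} (k : ptEl hS t ⟶ x) :
    Function.Injective (mp D k) := fun _ _ h =>
  Met.eq_of_isPullback (isPullback_mp D k) h rfl

/-- Every point of a member already lives in a fibre over a point of `T`, because the sieve contains
all points. -/
theorem exists_mp_ptEl (hS : S ∈ lsm T) {x : El S.functor} (p : tot D x) {t : T.toMet}
    (ht : loc x (pr D x p) = t) :
    ∃ (k : ptEl hS t ⟶ x) (r : tot D (ptEl hS t)), mp D k r = p := by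
  obtain ⟨k, hk⟩ := exists_hom_ptEl hS ht
  obtain ⟨r, hr, -⟩ := Met.exists_of_isPullback (isPullback_mp D k) (a := p) (v := PUnit.unit)
    (by rw [hk]; rfl)
  exact ⟨k, r, hr⟩

/-! ### Uniqueness of glued families -/

section Uniqueness

variable {D} {a b : GH.{u}.obj} {c : ∀ x, D.obj x ⟶ a} {c' : ∀ x, D.obj x ⟶ b}

theorem isPullback_of_isGlueing (hc : IsGlueing D (fun x => x.elt.1) a c) (x : El S.functor) :
    IsPullback (c x).hom.onTotal (pr D x) (GH.projTo hc.base) (loc x) :=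
  GH.isPullback _ _ (hc.lift x)

theorem onTotal_mp (hc : IsGlueing D (fun x => x.elt.1) a c) {x y : El S.functor} (h : x ⟶ y)
    (p : tot D x) : (c y).hom.onTotal (mp D h p) = (c x).hom.onTotal p := by
  rw [← hc.w h]
  rfl

theorem exists_onTotal_eq (hS : S ∈ lsm T) (hc : IsGlueing D (fun x => x.elt.1) a c)
    (α : a.obj.total) : ∃ (x : El S.functor) (p : tot D x), (c x).hom.onTotal p = α := by
  obtain ⟨p, hp, -⟩ := Met.exists_of_isPullback
    (isPullback_of_isGlueing hc (ptEl hS (GH.projTo hc.base α))) (a := α) (v := PUnit.unit) rfl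
  exact ⟨_, p, hp⟩

/-- Points with the same image in `a` lie over the same point of `T`. Both come from the fibre
there, which embeds in `a`, so they come from the same element of it. -/
theorem onTotal_eq_of_eq (hS : S ∈ lsm T) (hc : IsGlueing D (fun x => x.elt.1) a c)
    (hc' : IsGlueing D (fun x => x.elt.1) b c') {x y : El S.functor} {p : tot D x} {p' : tot D y}
    (e : (c x).hom.onTotal p = (c y).hom.onTotal p') :
    (c' x).hom.onTotal p = (c' y).hom.onTotal p' := by
  have h1 := DFunLike.congr_fun (isPullback_of_isGlueing hc x).w p
  have h2 := DFunLike.congr_fun (isPullback_of_isGlueing hc y).w p'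
  have h3 : loc y (pr D y p') = loc x (pr D x p) :=
    h2.symm.trans ((congrArg (GH.projTo hc.base) e).symm.trans h1)
  obtain ⟨k, r, hr⟩ := exists_mp_ptEl D hS p rfl
  obtain ⟨k', r', hr'⟩ := exists_mp_ptEl D hS p' h3
  rw [← hr, ← hr', onTotal_mp hc, onTotal_mp hc] at e
  rw [← hr, ← hr', onTotal_mp hc', onTotal_mp hc',
    Met.eq_of_isPullback (isPullback_of_isGlueing hc _) e rfl]

/-- Lift the two base points to one member with distance increased by less than `δ`. There the
distance is the maximum of the distance in `a` and the base distance, hence exceeds the former by at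
most `δ`, and the map to `b` is 1-Lipschitz. -/
theorem dist_le_of_isGlueing (hS : S ∈ lsm T) (hc : IsGlueing D (fun x => x.elt.1) a c)
    (hc' : IsGlueing D (fun x => x.elt.1) b c') {x y : El S.functor} (p : tot D x) (p' : tot D y) :
    dist ((c' x).hom.onTotal p) ((c' y).hom.onTotal p') ≤
      dist ((c x).hom.onTotal p) ((c y).hom.onTotal p') := by
  refine le_of_forall_pos_le_add fun δ hδ => ?_
  obtain ⟨z, u₁, u₂, -, h1, h2, -, hd, -⟩ := exists_lift_of_mem_lsm hS
    (GH.projTo hc.base ((c x).hom.onTotal p)) (GH.projTo hc.base ((c y).hom.onTotal p'))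
    (GH.projTo hc.base ((c y).hom.onTotal p')) hδ
  have hz := isPullback_of_isGlueing hc z
  obtain ⟨r, hr, hru⟩ := Met.exists_of_isPullback hz h1.symm
  obtain ⟨r', hr', hru'⟩ := Met.exists_of_isPullback hz h2.symm
  rw [← onTotal_eq_of_eq hS hc hc' hr, ← onTotal_eq_of_eq hS hc hc' hr']
  refine (Met.dist_map_le (c' z).hom.onTotal r r').trans ?_
  rw [Met.dist_of_isPullback hz, hr, hr', hru, hru']
  refine max_le (by linarith) (hd.le.trans ?_)
  gcongr
  exact Met.dist_map_le (GH.projTo hc.base) _ _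

theorem existsUnique_hom (hS : S ∈ lsm T) (hc : IsGlueing D (fun x => x.elt.1) a c)
    (hc' : IsGlueing D (fun x => x.elt.1) b c') :
    ∃! σ : a ⟶ b, GH.{u}.p.IsHomLift (𝟙 T) σ ∧ ∀ x, c x ≫ σ = c' x := by
  choose x p hp using exists_onTotal_eq hS hc
  let s : a.obj.total ⟶ b.obj.total := Met.Hom.mk (fun α => (c' (x α)).hom.onTotal (p α))
    fun α β => by
      have := dist_le_of_isGlueing hS hc hc' (p α) (p β)
      rwa [hp, hp] at this
  have hs : ∀ y q, s ((c y).hom.onTotal q) = (c' y).hom.onTotal q := fun y q =>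
    onTotal_eq_of_eq hS hc hc' (hp _)
  have hpb : IsPullback s (GH.projTo hc.base) (GH.projTo hc'.base) (TBMet.incl.map (𝟙 T)) := by
    have w : ∀ α, GH.projTo hc'.base (s α) = GH.projTo hc.base α := fun α => by
      obtain ⟨y, q, rfl⟩ := exists_onTotal_eq hS hc α
      rw [hs]
      exact (DFunLike.congr_fun (isPullback_of_isGlueing hc' y).w q).trans
        (DFunLike.congr_fun (isPullback_of_isGlueing hc y).w q).symm
    refine Met.isPullback_of_dist w (fun α β => le_max_of_le_left ?_) fun β v e => ?_
    · obtain ⟨y, q, rfl⟩ := exists_onTotal_eq hS hc α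
      obtain ⟨z, r, rfl⟩ := exists_onTotal_eq hS hc β
      rw [hs, hs]
      exact dist_le_of_isGlueing hS hc' hc q r
    · obtain ⟨y, q, rfl⟩ := exists_onTotal_eq hS hc' β
      exact ⟨(c y).hom.onTotal q, hs y q, by rw [← w, hs]; exact e⟩
  obtain ⟨σ, hσ, hσ'⟩ := GH.exists_hom hc.base hc'.base hpb
  have hcσ : ∀ y, GH.{u}.p.IsHomLift y.elt.1 (c y ≫ σ) := fun y => by
    have := hc.lift y
    infer_instance
  refine ⟨σ, ⟨hσ, fun y => GH.hom_ext (hcσ y) (hc'.lift y) fun q => ?_⟩, ?_⟩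
  · exact (DFunLike.congr_fun hσ' _).trans (hs y q)
  · rintro τ ⟨hτ, hτ'⟩
    refine GH.hom_ext hτ hσ fun α => ?_
    obtain ⟨y, q, rfl⟩ := exists_onTotal_eq hS hc α
    rw [hσ', hs, ← hτ']
    rfl

end Uniqueness

/-! ### Construction of the glued family -/

section Existence

variable (hS : S ∈ lsm T)

/-- The underlying set of the space glued from a descent datum: the disjoint union of the fibres
over the points of `T`. -/
structure Glued : Type u where
  base : T.toMet
  point : tot D (ptEl hS base)

/-- The relation between the members of a descent datum and the glued space. -/
def Rel (x : El S.functor) (p : tot D x) (q : Glued D hS) : Prop :=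
  ∃ k : ptEl hS q.1 ⟶ x, mp D k q.2 = p

variable {D hS} {x y : El S.functor} {p p₀ p₁ : tot D x} {q q' q₀ q₁ : Glued D hS}

theorem Rel.map (h : Rel D hS x p q) (k : x ⟶ y) : Rel D hS y (mp D k p) q := by
  obtain ⟨l, rfl⟩ := h
  exact ⟨l ≫ k, mp_comp D l k q.2⟩

theorem pr_mp_ptEl {t : T.toMet} (k : ptEl hS t ⟶ x) (r : tot D (ptEl hS t)) :
    pr D x (mp D k r) = TBMet.incl.map k.1 PUnit.unit :=
  pr_mp D k r

theorem Rel.loc_eq (h : Rel D hS x p q) : loc x (pr D x p) = q.1 := by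
  obtain ⟨k, rfl⟩ := h
  rw [pr_mp_ptEl]
  exact loc_map k PUnit.unit

theorem exists_rel (x : El S.functor) (p : tot D x) : ∃ q, Rel D hS x p q := by
  obtain ⟨k, r, hr⟩ := exists_mp_ptEl D hS p rfl
  exact ⟨⟨_, r⟩, k, hr⟩

theorem hom_ptEl_ext {t : T.toMet} {k k' : ptEl hS t ⟶ x}
    (h : TBMet.incl.map k.1 PUnit.unit = TBMet.incl.map k'.1 PUnit.unit) : k = k' :=
  Subtype.ext (TBMet.hom_ext fun _ => h)

/-- Two representations by `p` use the same arrow from the same point, since the arrow is determined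
by the projection of `p`. Arrows out of a point act injectively. -/
theorem Rel.unique (h : Rel D hS x p q) (h' : Rel D hS x p q') : q = q' := by
  have e := h.loc_eq.symm.trans h'.loc_eq
  obtain ⟨t, r⟩ := q
  obtain ⟨t', r'⟩ := q'
  obtain rfl : t = t' := e
  obtain ⟨k, hk⟩ := h
  obtain ⟨k', hk'⟩ := h'
  obtain rfl : k = k' := hom_ptEl_ext (by rw [← pr_mp_ptEl, hk, ← pr_mp_ptEl, hk'])
  exact congrArg _ (mp_ptEl_injective D hS k (hk.trans hk'.symm))

theorem Rel.injective (h₀ : Rel D hS x p₀ q) (h₁ : Rel D hS x p₁ q)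
    (e : pr D x p₀ = pr D x p₁) : p₀ = p₁ := by
  obtain ⟨k, hk⟩ := h₀
  obtain ⟨k', hk'⟩ := h₁
  obtain rfl : k = k' := hom_ptEl_ext (by rw [← pr_mp_ptEl, hk, ← pr_mp_ptEl, hk', e])
  rw [← hk, ← hk']

theorem exists_rel_over (q : Glued D hS) {v : x.base.toMet} (hv : loc x v = q.1) :
    ∃ p, Rel D hS x p q ∧ pr D x p = v := by
  obtain ⟨k, hk⟩ := exists_hom_ptEl hS hv
  refine ⟨mp D k q.2, ⟨k, rfl⟩, ?_⟩
  rw [pr_mp_ptEl, hk]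
  rfl

-- The two base points in `y` form a space `Z` that maps to the base of `y` by inclusion and,
-- because of `hd`, to the base of `x` by a 1-Lipschitz map. The member over `Z` is a base change of
-- both, and its distance is computed in two ways.
open Classical in
theorem Rel.dist_eq_max {p₀' p₁' : tot D y} (h₀ : Rel D hS x p₀ q₀) (h₁ : Rel D hS x p₁ q₁)
    (h₀' : Rel D hS y p₀' q₀) (h₁' : Rel D hS y p₁' q₁)
    (hd : dist (pr D x p₀) (pr D x p₁) ≤ dist (pr D y p₀') (pr D y p₁')) :
    dist p₀' p₁' = max (dist p₀ p₁) (dist (pr D y p₀') (pr D y p₁')) := by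
  let Z : TBMet.{u} := ⟨⟨({pr D y p₀', pr D y p₁'} : Set y.base.toMet)⟩,
    Set.finite_univ.totallyBounded⟩
  let f : Z ⟶ y.base := Met.Hom.mk (fun z => z.1) fun _ _ => le_rfl
  -- If the two base points in `y` coincide, then `hd` forces those in `x` to coincide too, so the
  -- case distinction is consistent.
  let g : Z ⟶ x.base := Met.Hom.mk (fun z => if z.1 = pr D y p₀' then pr D x p₀ else pr D x p₁) (by
    rintro ⟨a, rfl | rfl⟩ ⟨b, rfl | rfl⟩
    · simp
    · change dist _ _ ≤ dist (pr D y p₀') (pr D y p₁')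
      simp only [if_true]
      split_ifs
      · simp
      · exact hd
    · change dist _ _ ≤ dist (pr D y p₁') (pr D y p₀')
      simp only [if_true]
      split_ifs
      · simp
      · rw [dist_comm, dist_comm (pr D y p₁')]
        exact hd
    · simp)
  let z₀ : Z.toMet := ⟨pr D y p₀', Or.inl rfl⟩
  let z₁ : Z.toMet := ⟨pr D y p₁', Or.inr rfl⟩
  have hg₀ : TBMet.incl.map g z₀ = pr D x p₀ := if_pos rfl
  have hg₁ : TBMet.incl.map g z₁ = pr D x p₁ := by
    by_cases e : pr D y p₁' = pr D y p₀'
    · rw [e, dist_self] at hd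
      exact (if_pos e).trans (dist_le_zero.1 hd)
    · exact if_neg e
  have hz : ∀ z : Z.toMet, z = z₀ ∨ z = z₁ := by
    rintro ⟨z, hz⟩
    exact hz.imp Subtype.ext Subtype.ext
  let z : El S.functor := ⟨Z, ⟨f ≫ y.elt.1, S.downward_closed y.elt.2 f⟩⟩
  obtain ⟨k, hk⟩ := El.exists_hom_sieve (x := z) (y := y) f fun _ => rfl
  obtain ⟨l, hl⟩ := El.exists_hom_sieve (x := z) (y := x) g fun v => by
    rcases hz v with rfl | rfl
    · rw [hg₀]
      exact h₀.loc_eq.trans h₀'.loc_eq.symm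
    · rw [hg₁]
      exact h₁.loc_eq.trans h₁'.loc_eq.symm
  have key : ∀ (s : Z.toMet) (p' : tot D y) (p : tot D x) (q : Glued D hS), Rel D hS y p' q →
      Rel D hS x p q → pr D y p' = TBMet.incl.map f s → pr D x p = TBMet.incl.map g s →
      ∃ r : tot D z, mp D k r = p' ∧ mp D l r = p ∧ pr D z r = s := by
    intro s p' p q h' h e' e
    obtain ⟨r, hr, hrs⟩ := Met.exists_of_isPullback (isPullback_mp D k) (a := p') (v := s)
      (by rw [hk]; exact e')
    refine ⟨r, hr, ?_, hrs⟩
    obtain ⟨q', hq'⟩ := exists_rel (hS := hS) z r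
    have h2 := hq'.map k
    rw [hr] at h2
    obtain rfl := h2.unique h'
    exact (hq'.map l).injective h (by rw [pr_mp, hrs, hl, e])
  obtain ⟨r₀, hk₀, hl₀, hr₀⟩ := key z₀ _ _ _ h₀' h₀ rfl hg₀.symm
  obtain ⟨r₁, hk₁, hl₁, hr₁⟩ := key z₁ _ _ _ h₁' h₁ rfl hg₁.symm
  have e1 := Met.dist_of_isPullback (isPullback_mp D k) r₀ r₁
  have e2 := Met.dist_of_isPullback (isPullback_mp D l) r₀ r₁
  have e3 : dist (pr D z r₀) (pr D z r₁) = dist (pr D y p₀') (pr D y p₁') := by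
    rw [hr₀, hr₁]
    rfl
  rw [e3, hk₀, hk₁] at e1
  rw [e3, hl₀, hl₁] at e2
  rw [← e2, e1, max_eq_left (Met.dist_map_le (pr D y) _ _)]

/-- The infimum is needed: a member over a base where the two points lie far apart overestimates
their distance. -/
instance : Dist (Glued D hS) where
  dist q₀ q₁ := sInf {d : ℝ | ∃ (x : El S.functor) (p₀ p₁ : tot D x),
    Rel D hS x p₀ q₀ ∧ Rel D hS x p₁ q₁ ∧ d = dist p₀ p₁}

theorem Rel.dist_le (h₀ : Rel D hS x p₀ q₀) (h₁ : Rel D hS x p₁ q₁) :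
    dist q₀ q₁ ≤ dist p₀ p₁ :=
  csInf_le ⟨0, by rintro _ ⟨_, _, _, _, _, rfl⟩; exact dist_nonneg⟩ ⟨x, p₀, p₁, h₀, h₁, rfl⟩

theorem exists_rel_of_dist (q₀ q₁ q₂ : Glued D hS) {δ : ℝ} (hδ : 0 < δ) :
    ∃ (x : El S.functor) (p₀ p₁ p₂ : tot D x), Rel D hS x p₀ q₀ ∧ Rel D hS x p₁ q₁ ∧
      Rel D hS x p₂ q₂ ∧ dist (pr D x p₀) (pr D x p₁) < dist q₀.1 q₁.1 + δ ∧
      dist (pr D x p₁) (pr D x p₂) < dist q₁.1 q₂.1 + δ := by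
  obtain ⟨x, u₀, u₁, u₂, h₀, h₁, h₂, hd, hd'⟩ := exists_lift_of_mem_lsm hS q₀.1 q₁.1 q₂.1 hδ
  obtain ⟨p₀, hp₀, rfl⟩ := exists_rel_over q₀ h₀
  obtain ⟨p₁, hp₁, rfl⟩ := exists_rel_over q₁ h₁
  obtain ⟨p₂, hp₂, rfl⟩ := exists_rel_over q₂ h₂
  exact ⟨x, p₀, p₁, p₂, hp₀, hp₁, hp₂, hd, hd'⟩

theorem le_dist_of_forall_rel {d : ℝ}
    (h : ∀ (x : El S.functor) (p₀ p₁ : tot D x), Rel D hS x p₀ q₀ → Rel D hS x p₁ q₁ →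
      d ≤ dist p₀ p₁) : d ≤ dist q₀ q₁ := by
  obtain ⟨x, p₀, p₁, -, h₀, h₁, -⟩ := exists_rel_of_dist q₀ q₁ q₁ one_pos
  refine le_csInf ⟨_, x, p₀, p₁, h₀, h₁, rfl⟩ ?_
  rintro _ ⟨x, p₀, p₁, h₀, h₁, rfl⟩
  exact h x p₀ p₁ h₀ h₁

theorem dist_fst_le (q₀ q₁ : Glued D hS) : dist q₀.1 q₁.1 ≤ dist q₀ q₁ :=
  le_dist_of_forall_rel fun x p₀ p₁ h₀ h₁ => by
    rw [← h₀.loc_eq, ← h₁.loc_eq]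
    exact (Met.dist_map_le (loc x) _ _).trans (Met.dist_map_le (pr D x) _ _)

/-- If the distance in `x` exceeds the base distance there, then by `Rel.dist_eq_max` no other
member gives a smaller value, so the infimum is attained at `x`. -/
theorem Rel.dist_eq (h₀ : Rel D hS x p₀ q₀) (h₁ : Rel D hS x p₁ q₁) :
    dist p₀ p₁ = max (dist q₀ q₁) (dist (pr D x p₀) (pr D x p₁)) := by
  refine le_antisymm ?_ (max_le (h₀.dist_le h₁) (Met.dist_map_le (pr D x) _ _))
  rcases le_or_gt (dist p₀ p₁) (dist (pr D x p₀) (pr D x p₁)) with h | h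
  · exact le_max_of_le_right h
  · refine le_max_of_le_left (le_dist_of_forall_rel fun y p₀' p₁' h₀' h₁' => ?_)
    rcases le_total (dist (pr D x p₀) (pr D x p₁)) (dist (pr D y p₀') (pr D y p₁')) with h' | h'
    · rw [h₀.dist_eq_max h₁ h₀' h₁' h']
      exact le_max_left _ _
    · have := h₀'.dist_eq_max h₁' h₀ h₁ h'
      rcases max_choice (dist p₀' p₁') (dist (pr D x p₀) (pr D x p₁)) with e | e
      · rw [this, e]
      · rw [e] at this
        exact absurd this h.ne'

instance : MetricSpace (Glued D hS) where
  dist_self q := by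
    obtain ⟨x, p, -, -, h, -⟩ := exists_rel_of_dist q q q one_pos
    refine le_antisymm ((h.dist_le h).trans_eq (dist_self p)) ?_
    exact dist_nonneg.trans (dist_fst_le q q)
  dist_comm := by
    have : ∀ q₀ q₁ : Glued D hS, dist q₀ q₁ ≤ dist q₁ q₀ := fun q₀ q₁ =>
      le_dist_of_forall_rel fun x p₁ p₀ h₁ h₀ => (h₀.dist_le h₁).trans_eq (dist_comm _ _)
    exact fun q₀ q₁ => le_antisymm (this _ _) (this _ _)
  dist_triangle q₀ q₁ q₂ := by
    refine le_of_forall_pos_le_add fun δ hδ => ?_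
    -- Here all three points must be lifted to one member. Only the two sides meeting at `q₁` need
    -- to be nearly preserved, the third being bounded by the triangle inequality in that member.
    obtain ⟨x, p₀, p₁, p₂, h₀, h₁, h₂, hd, hd'⟩ := exists_rel_of_dist q₀ q₁ q₂ (half_pos hδ)
    have h01 := dist_fst_le q₀ q₁
    have h12 := dist_fst_le q₁ q₂
    have e01 : dist p₀ p₁ ≤ dist q₀ q₁ + δ / 2 := by
      rw [h₀.dist_eq h₁]
      exact max_le (by linarith) (by linarith)
    have e12 : dist p₁ p₂ ≤ dist q₁ q₂ + δ / 2 := by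
      rw [h₁.dist_eq h₂]
      exact max_le (by linarith) (by linarith)
    linarith [h₀.dist_le h₂, dist_triangle p₀ p₁ p₂]
  eq_of_dist_eq_zero {q₀ q₁} h := by
    have e : q₀.1 = q₁.1 := dist_le_zero.1 ((dist_fst_le q₀ q₁).trans_eq h)
    -- Over a single point the base distance is zero, so by `Rel.dist_eq` the fibre embeds
    -- isometrically.
    obtain ⟨p₀, hp₀, -⟩ := exists_rel_over (x := ptEl hS q₀.1) (v := PUnit.unit) q₀ rfl
    obtain ⟨p₁, hp₁, -⟩ := exists_rel_over (x := ptEl hS q₀.1) (v := PUnit.unit) q₁ e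
    have h2 : dist p₀ p₁ = 0 := by
      rw [hp₀.dist_eq hp₁, h]
      exact (max_eq_left (dist_self (α := PUnit) _).le)
    rw [dist_eq_zero] at h2
    subst h2
    exact hp₀.unique hp₁

variable (D hS) in
/-- The projection of the glued space. -/
def gluedProj : (⟨Glued D hS⟩ : Met.{u}) ⟶ T.toMet := Met.Hom.mk (fun q => q.1) dist_fst_le

theorem exists_toGlued (x : El S.functor) :
    ∃ c : tot D x ⟶ (⟨Glued D hS⟩ : Met.{u}), ∀ p, Rel D hS x p (c p) := by
  choose c hc using exists_rel (D := D) (hS := hS) x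
  exact ⟨Met.Hom.mk c fun p p' => (hc p).dist_le (hc p'), hc⟩

theorem isPullback_toGlued {c : tot D x ⟶ (⟨Glued D hS⟩ : Met.{u})}
    (hc : ∀ p, Rel D hS x p (c p)) : IsPullback c (pr D x) (gluedProj D hS) (loc x) := by
  refine Met.isPullback_of_dist (fun p => (hc p).loc_eq.symm)
    (fun p p' => ((hc p).dist_eq (hc p')).le) fun q v e => ?_
  obtain ⟨p, hp, hv⟩ := exists_rel_over q e.symm
  exact ⟨p, (hc p).unique hp, hv⟩

variable (D hS) in
theorem isProperSubmetry_gluedProj : IsProperSubmetry (gluedProj D hS) := by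
  have hx := fun x => isProperSubmetry_iff.1 (isProperSubmetry_pr D x)
  choose c hc using exists_toGlued (D := D) (hS := hS)
  rw [isProperSubmetry_iff]
  have hsurj : Function.Surjective (gluedProj D hS) := fun t => by
    obtain ⟨p, -⟩ := (hx (ptEl hS t)).1 PUnit.unit
    exact ⟨c _ p, (hc _ p).loc_eq.symm⟩
  have hcomp : ∀ t, IsCompact (gluedProj D hS ⁻¹' {t}) := fun t => by
    convert ((hx (ptEl hS t)).2.1 PUnit.unit).image (Met.continuous (c _)) using 1
    ext q
    constructor
    · rintro rfl
      obtain ⟨p, hp, hv⟩ := exists_rel_over (x := ptEl hS q.1) (v := PUnit.unit) q rfl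
      exact ⟨p, rfl, (hc _ p).unique hp⟩
    · rintro ⟨p, -, rfl⟩
      exact (hc _ p).loc_eq.symm
  refine ⟨hsurj, hcomp, fun q t => ?_⟩
  have hne : (gluedProj D hS ⁻¹' {t}).Nonempty := hsurj t
  obtain ⟨q', hq', e⟩ := (hcomp t).exists_infDist_eq_dist hne q
  refine ⟨q', hq', ?_⟩
  -- A lift inside a member loses an arbitrarily small `δ`. The nearest point `q'` of the compact
  -- fibre is fixed beforehand, so the bound holds for it in the limit.
  rw [← e]
  refine le_of_forall_pos_le_add fun δ hδ => ?_
  obtain ⟨x, u₀, u₁, -, h₀, h₁, -, hd, -⟩ := exists_lift_of_mem_lsm hS q.1 t t hδ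
  obtain ⟨p₀, hp₀, rfl⟩ := exists_rel_over q h₀
  obtain ⟨p₁, rfl, hle⟩ := (hx x).2.2 p₀ u₁
  have h2 : c x p₁ ∈ gluedProj D hS ⁻¹' {t} := (hc x p₁).loc_eq.symm.trans h₁
  exact (Metric.infDist_le_dist_of_mem h2).trans
    ((hp₀.dist_le (hc x p₁)).trans (hle.trans hd.le))

variable (D) in
theorem exists_isGlueing (hS : S ∈ lsm T) :
    ∃ (a : GH.{u}.obj) (c : ∀ x, D.obj x ⟶ a), IsGlueing D (fun x => x.elt.1) a c := by
  choose c hc using exists_toGlued (D := D) (hS := hS)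
  let a : GH.{u}.obj := ⟨⟨T, ⟨Glued D hS⟩, gluedProj D hS⟩, isProperSubmetry_gluedProj D hS⟩
  have hpb : ∀ x : El S.functor, IsPullback (c x) (GH.projTo (D.w_obj x))
      (GH.projTo (P := a) (T := T) rfl) (TBMet.incl.map x.elt.1) := fun x =>
    isPullback_toGlued (hc x)
  choose d hd hdc using fun x => GH.exists_hom (D.w_obj x) (Q := a) (T := T) rfl (hpb x)
  refine ⟨a, d, rfl, hd, fun {x y} h => ?_⟩
  have h1 := isHomLift_el_map D h
  have h2 := hd y
  have h3 : GH.{u}.p.IsHomLift (h.1 ≫ y.elt.1) (D.map h ≫ d y) := inferInstance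
  rw [show h.1 ≫ y.elt.1 = x.elt.1 from congrArg Subtype.val h.2] at h3
  refine GH.hom_ext h3 (hd x) fun p => ?_
  change (d y).hom.onTotal (mp D h p) = _
  rw [hdc, hdc]
  exact (hc y _).unique ((hc x p).map h)

end Existence

end Descent

theorem GH.isStackInGroupoids : IsStackInGroupoids lsm GH.{u} :=
  isStackInGroupoids_of_isGlueing GH.isFibredInGroupoids
    (fun _ _ hS D => Descent.exists_isGlueing D hS)
    fun _ _ hS _ _ _ _ _ hc hc' => Descent.existsUnique_hom hS hc hc'

/-! ### Sheaves as stacks -/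

section ElStack

variable {C : Type u} [Category.{v} C] {F : Cᵒᵖ ⥤ Type v}

/-- The element of `F(T)` underlying an object of the category of elements over `T`. -/
def eltTo {x : (el F).obj} {T : C} (h : (el F).p.obj x = T) : F.obj (op T) :=
  F.map (eqToHom h.symm).op (El.elt x)

theorem eltTo_self (x : El F) : eltTo (x := x) (T := x.base) rfl = x.elt := by
  simp [eltTo]

theorem map_eltTo {x y : (el F).obj} {V T : C} (hx : (el F).p.obj x = V)
    (hy : (el F).p.obj y = T) {f : V ⟶ T} {φ : x ⟶ y} (h : (el F).p.IsHomLift f φ) :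
    F.map f.op (eltTo hy) = eltTo hx := by
  subst hx hy
  obtain rfl := IsHomLift.eq_of_isHomLift (el F).p f φ
  rw [eltTo_self, eltTo_self]
  exact φ.2

theorem exists_el_hom {x y : (el F).obj} {V T : C} (hx : (el F).p.obj x = V)
    (hy : (el F).p.obj y = T) {f : V ⟶ T} (h : F.map f.op (eltTo hy) = eltTo hx) :
    ∃ φ : x ⟶ y, (el F).p.IsHomLift f φ := by
  subst hx hy
  rw [eltTo_self, eltTo_self] at h
  let φ : x ⟶ y := ⟨f, h⟩
  exact ⟨φ, Functor.IsHomLift.map (p := (el F).p) φ⟩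

theorem el_hom_ext {x y : (el F).obj} {V T : C} {f : V ⟶ T} {φ ψ : x ⟶ y}
    (hφ : (el F).p.IsHomLift f φ) (hψ : (el F).p.IsHomLift f ψ) : φ = ψ := by
  obtain rfl := IsHomLift.domain_eq (el F).p f φ
  obtain rfl := IsHomLift.codomain_eq (el F).p f φ
  obtain rfl := IsHomLift.eq_of_isHomLift (el F).p f φ
  exact Subtype.ext (IsHomLift.eq_of_isHomLift (el F).p ((el F).p.map φ) ψ)

theorem isFibredInGroupoids_el (F : Cᵒᵖ ⥤ Type v) : IsFibredInGroupoids (el F) := by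
  refine ⟨fun x V f => ?_, fun {x y} φ =>
    { toIsHomLift := Functor.IsHomLift.map (p := (el F).p) φ
      universal_property' := fun {z} g ψ hψ => ?_ }⟩
  · let y : El F := ⟨V, F.map f.op (El.elt x)⟩
    let φ : y ⟶ x := ⟨f, rfl⟩
    exact ⟨y, φ, Functor.IsHomLift.map (p := (el F).p) φ⟩
  · have e := IsHomLift.eq_of_isHomLift (el F).p (g ≫ (el F).p.map φ) ψ
    have h : F.map g.op (El.elt y) = El.elt z := by
      have h1 := ψ.2
      rw [← show g ≫ φ.1 = ψ.1 from e, op_comp, Functor.map_comp_apply, φ.2] at h1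
      exact h1
    let χ : z ⟶ y := ⟨g, h⟩
    have hχ : (el F).p.IsHomLift g χ := Functor.IsHomLift.map (p := (el F).p) χ
    exact ⟨χ, ⟨hχ, Subtype.ext e⟩, fun χ' h' => el_hom_ext h'.1 hχ⟩

/-- A descent datum is a compatible family of elements and a cocone is an amalgamation. Arrows are
determined by their images in the base, so uniqueness is separatedness. -/
theorem isStackInGroupoids_el {J : GrothendieckTopology C} (hF : Presieve.IsSheaf J F) :
    IsStackInGroupoids J (el F) := by
  refine isStackInGroupoids_of_isGlueing (isFibredInGroupoids_el F) (fun T S hS D => ?_)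
    fun T S hS D a b c c' hc hc' => ?_
  · let s : Presieve.FamilyOfElements F S.arrows := fun V f hf => eltTo (D.w_obj ⟨V, ⟨f, hf⟩⟩)
    have hs : s.Compatible := by
      rw [Presieve.compatible_iff_sieveCompatible]
      intro Y Z f g hf
      let h : (⟨Z, ⟨g ≫ f, S.downward_closed hf g⟩⟩ : El S.functor) ⟶ ⟨Y, ⟨f, hf⟩⟩ := ⟨g, rfl⟩
      exact (map_eltTo _ _ (isHomLift_el_map D h)).symm
    obtain ⟨a, ha, -⟩ := hF S hS s hs
    choose c hc using fun x : El S.functor => exists_el_hom (D.w_obj x)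
      (y := (⟨T, a⟩ : El F)) (T := T) rfl (f := x.elt.1)
      ((congrArg _ (eltTo_self _)).trans (ha x.elt.1 x.elt.2))
    refine ⟨_, c, rfl, hc, fun {x y} h => ?_⟩
    have h1 := isHomLift_el_map D h
    have h2 := hc y
    have h3 : (el F).p.IsHomLift (h.1 ≫ y.elt.1) (D.map h ≫ c y) := inferInstance
    rw [show h.1 ≫ y.elt.1 = x.elt.1 from congrArg Subtype.val h.2] at h3
    exact el_hom_ext h3 (hc x)
  · have e : eltTo hc.base = eltTo hc'.base := (hF S hS).isSeparatedFor.ext fun V f hf =>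
      (map_eltTo (D.w_obj ⟨V, ⟨f, hf⟩⟩) hc.base (hc.lift ⟨V, ⟨f, hf⟩⟩)).trans
        (map_eltTo (D.w_obj ⟨V, ⟨f, hf⟩⟩) hc'.base (hc'.lift ⟨V, ⟨f, hf⟩⟩)).symm
    obtain ⟨σ, hσ⟩ := exists_el_hom hc.base hc'.base (f := 𝟙 T) (by simp [e])
    refine ⟨σ, ⟨hσ, fun x => ?_⟩, fun τ hτ => el_hom_ext hτ.1 hσ⟩
    have := hc.lift x
    exact el_hom_ext (f := x.elt.1) inferInstance (hc'.lift x)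

end ElStack

theorem evalAt_ext {X : Met.{u}} {T : TBMet.{u}} {s s' : (hMet.obj X).obj (op T)}
    (h : ∀ t, evalAt s t = evalAt s' t) : s = s' :=
  Met.hom_ext (X := T.toMet) (Y := X) h

/-- The sieve contains the points of `T`, so the values of the glued map are forced. It is
1-Lipschitz because pairs of points lift with arbitrarily small increase of distance. -/
theorem isSheaf_hMet (X : Met.{u}) : Presieve.IsSheaf lsm (hMet.obj X) := by
  intro T S hS s hs
  rw [Presieve.compatible_iff_sieveCompatible] at hs
  let g : T.toMet → X := fun t => evalAt (s (TBMet.point t) (point_mem_of_mem_lsm hS t)) PUnit.unit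
  have hg : ∀ (x : El S.functor) (v : x.base.toMet),
      g (loc x v) = evalAt (s x.elt.1 x.elt.2) v := fun x v =>
    congrArg (fun a => evalAt (X := X) (T := TBMet.pt) a PUnit.unit)
      (hs x.elt.1 (TBMet.point v) x.elt.2)
  have hl : ∀ t t', dist (g t) (g t') ≤ dist t t' := fun t t' => by
    refine le_of_forall_pos_le_add fun δ hδ => ?_
    obtain ⟨x, u, u', -, rfl, rfl, -, h, -⟩ := exists_lift_of_mem_lsm hS t t' t' hδ
    rw [hg, hg]
    exact (Met.Hom.dist_le (s x.elt.1 x.elt.2) u u').trans h.le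
  refine ⟨Met.Hom.mk g hl, fun V f hf => ?_, fun g' hg' => ?_⟩
  · exact evalAt_ext fun v => hg ⟨V, ⟨f, hf⟩⟩ v
  · refine evalAt_ext fun t => ?_
    exact congrArg (fun a => evalAt (X := X) (T := TBMet.pt) a PUnit.unit)
      (hg' (TBMet.point t) (point_mem_of_mem_lsm hS t))

/-! ### Families of compact subsets as maps to `Cpt` -/

section Cpt

variable {X T : Met.{u}} {A : Set (X × T)}

/-- The slice over `t` of a subset of `X × T`. -/
def slice (A : Set (X × T)) (t : T) : Set X := {x | (x, t) ∈ A}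

/-- With the maximum metric on `X × T`, a slice is isometric to a fibre, and a lift is optimal once
its `X`-component moves by at most the base distance. -/
theorem isProperSubmetry_projSubset_iff : IsProperSubmetry (projSubset A) ↔
    (∀ t, (slice A t).Nonempty) ∧ (∀ t, IsCompact (slice A t)) ∧
      ∀ t t', ∀ x ∈ slice A t, ∃ x' ∈ slice A t', dist x x' ≤ dist t t' := by
  have hc : ∀ t, IsCompact (projSubset A ⁻¹' {t}) ↔ IsCompact (slice A t) := fun t => by
    have hi : Isometry fun a : projSubset A ⁻¹' {t} => a.1.1.1 :=
      Isometry.of_dist_eq fun a b => by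
        have ha : a.1.1.2 = t := a.2
        have hb : b.1.1.2 = t := b.2
        change _ = max _ (dist a.1.1.2 b.1.1.2)
        rw [ha, hb, dist_self, max_eq_left dist_nonneg]
    rw [isCompact_iff_isCompact_univ, hi.isUniformInducing.isInducing.isCompact_iff]
    convert Iff.rfl using 2
    ext x
    constructor
    · intro hx
      exact ⟨⟨⟨(x, t), hx⟩, rfl⟩, trivial, rfl⟩
    · rintro ⟨⟨⟨⟨x, t'⟩, hx⟩, ht⟩, -, rfl⟩
      obtain rfl : t' = t := ht
      exact hx
  rw [isProperSubmetry_iff]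
  refine and_congr ⟨fun h t => ?_, fun h t => ?_⟩ (and_congr (forall_congr' hc)
    ⟨fun h t t' x hx => ?_, ?_⟩)
  · obtain ⟨⟨⟨x, t⟩, hx⟩, rfl⟩ := h t
    exact ⟨x, hx⟩
  · obtain ⟨x, hx⟩ := h t
    exact ⟨⟨(x, t), hx⟩, rfl⟩
  · obtain ⟨⟨⟨x', t'⟩, hx'⟩, rfl, hd⟩ := h ⟨(x, t), hx⟩ t'
    exact ⟨x', hx', (le_max_left _ _).trans hd⟩
  · rintro h ⟨⟨x, t⟩, hx⟩ t'
    obtain ⟨x', hx', hd⟩ := h t t' x hx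
    exact ⟨⟨(x', t'), hx'⟩, rfl, max_le hd le_rfl⟩

theorem Cpt.dist_le_iff {K L : Cpt X} {r : ℝ} (hr : 0 ≤ r) : dist K L ≤ r ↔
    (∀ x ∈ Cpt.toSet K, ∃ y ∈ Cpt.toSet L, dist x y ≤ r) ∧
      ∀ x ∈ Cpt.toSet L, ∃ y ∈ Cpt.toSet K, dist x y ≤ r := by
  have key : ∀ {K L : Cpt X}, dist K L ≤ r → ∀ x ∈ Cpt.toSet K, ∃ y ∈ Cpt.toSet L,
      dist x y ≤ r := fun {K L} h x hx => by
    obtain ⟨y, hy, e⟩ := (NonemptyCompacts.isCompact L).exists_infDist_eq_dist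
      (NonemptyCompacts.nonempty L) x
    refine ⟨y, hy, e.symm.trans_le ((Metric.infDist_le_hausdorffDist_of_mem hx ?_).trans h)⟩
    exact Metric.hausdorffEDist_ne_top_of_nonempty_of_bounded (NonemptyCompacts.nonempty K)
      (NonemptyCompacts.nonempty L) (NonemptyCompacts.isCompact K).isBounded
      (NonemptyCompacts.isCompact L).isBounded
  exact ⟨fun h => ⟨key h, key ((dist_comm L K).trans_le h)⟩,
    fun h => Metric.hausdorffDist_le_of_mem_dist hr h.1 h.2⟩

theorem Cpt.ext {K L : Cpt X} (h : Cpt.toSet K = Cpt.toSet L) : K = L :=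
  NonemptyCompacts.ext h

/-- The map `T ⟶ Cpt(X)` given by the slices of a family of compact subsets. -/
def slices (hA : IsProperSubmetry (projSubset A)) : T ⟶ Cpt X :=
  have h := isProperSubmetry_projSubset_iff.1 hA
  Met.Hom.mk (fun t => ⟨⟨slice A t, h.2.1 t⟩, h.1 t⟩) fun t t' =>
    (Cpt.dist_le_iff dist_nonneg).2 ⟨h.2.2 t t', by rw [dist_comm]; exact h.2.2 t' t⟩

/-- The family of compact subsets with given slices. -/
def unslice (k : T ⟶ Cpt X) : Set (X × T) := {z | z.1 ∈ Cpt.toSet (k z.2)}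

theorem isProperSubmetry_unslice (k : T ⟶ Cpt X) : IsProperSubmetry (projSubset (unslice k)) :=
  isProperSubmetry_projSubset_iff.2 ⟨fun t => NonemptyCompacts.nonempty (k t),
    fun t => NonemptyCompacts.isCompact (k t),
    fun t t' => ((Cpt.dist_le_iff dist_nonneg).1 (Met.dist_map_le k t t')).1⟩

end Cpt

/-- The isomorphism between families of compact subsets and maps to `Cpt(X)`. -/
def inCptIso (X : Met.{u}) : inCpt X ≅ hMet.obj (Cpt X) :=
  NatIso.ofComponents (fun _ => Equiv.toIso
    { toFun := fun A => slices A.2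
      invFun := fun k => ⟨unslice k, isProperSubmetry_unslice k⟩
      left_inv := fun _ => rfl
      right_inv := fun _ => rfl }) fun _ => rfl

theorem toSet_inCptIso (X : Met.{u}) {T : TBMet.{u}} (A : (inCpt X).obj (op T)) (t : T.toMet) :
    Cpt.toSet (evalAt ((inCptIso X).hom.app _ A) t) = {x : X | (x, t) ∈ A.1} :=
  rfl

theorem isStackInGroupoids_metStack (X : Met.{u}) : IsStackInGroupoids lsm (metStack X) :=
  isStackInGroupoids_el (isSheaf_hMet X)

theorem isStackInGroupoids_inCpt (X : Met.{u}) : IsStackInGroupoids lsm (el (inCpt X)) :=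
  isStackInGroupoids_el (Presieve.isSheaf_iso lsm (inCptIso X).symm (isSheaf_hMet _))

/-! ### Katětov functions and their realization -/

theorem exists_seq_of_forall_exists {α : Type*} {P : ℕ → α → Prop} {R : ℕ → α → α → Prop}
    (h₀ : ∃ a, P 0 a) (h : ∀ n a, P n a → ∃ b, P (n + 1) b ∧ R n a b) :
    ∃ s : ℕ → α, (∀ n, P n (s n)) ∧ ∀ n, R n (s n) (s (n + 1)) := by
  choose f hf hR using h
  let s : ∀ n, {a // P n a} := fun n =>
    Nat.rec ⟨h₀.choose, h₀.choose_spec⟩ (fun n a => ⟨f n a.1 a.2, hf n a.1 a.2⟩) n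
  exact ⟨fun n => (s n).1, fun n => (s n).2, fun n => hR n (s n).1 (s n).2⟩

section Katetov

variable {X : Type*} [PseudoMetricSpace X]

/-- A Katětov function on a subset `K`: a function that could be the distance to a further
point. -/
def IsKatetovOn (f : X → ℝ) (K : Set X) : Prop :=
  ∀ x ∈ K, ∀ y ∈ K, f x - f y ≤ dist x y ∧ dist x y ≤ f x + f y

theorem IsKatetovOn.nonneg {f : X → ℝ} {K : Set X} (h : IsKatetovOn f K) {x : X} (hx : x ∈ K) :
    0 ≤ f x := by
  have := (h x hx x hx).2
  rw [dist_self] at this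
  linarith

theorem IsKatetovOn.abs_sub_le {f : X → ℝ} {K : Set X} (h : IsKatetovOn f K) {x y : X}
    (hx : x ∈ K) (hy : y ∈ K) : |f x - f y| ≤ dist x y :=
  abs_le.2 ⟨by linarith [(h y hy x hx).1, dist_comm x y], (h x hx y hy).1⟩

variable (X) in
/-- The Katětov functions on finite subsets are realized approximately. -/
def HasApproxExtension : Prop :=
  ∀ (s : Set X) (f : X → ℝ) (r : ℝ), s.Finite → IsKatetovOn f s → 0 < r →
    ∃ z, ∀ x ∈ s, |dist z x - f x| ≤ r

/-- Realize `f` up to `r / 3` on a finite `r / 3`-net. Both `f` and the distance to `z` are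
1-Lipschitz, which adds two more thirds. -/
theorem HasApproxExtension.of_totallyBounded (hX : HasApproxExtension X) {K : Set X}
    (hK : TotallyBounded K) {f : X → ℝ} (hf : IsKatetovOn f K) {r : ℝ} (hr : 0 < r) :
    ∃ z, ∀ x ∈ K, |dist z x - f x| ≤ r := by
  obtain ⟨t, htK, ht, hcov⟩ := totallyBounded_iff_subset.1 hK _
    (Metric.dist_mem_uniformity (show 0 < r / 3 by linarith))
  obtain ⟨z, hz⟩ := hX t f (r / 3) ht (fun x hx y hy => hf x (htK hx) y (htK hy)) (by linarith)
  refine ⟨z, fun x hx => ?_⟩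
  obtain ⟨y, hy, hxy⟩ := Set.mem_iUnion₂.1 (hcov hx)
  have hxy : dist x y < r / 3 := hxy
  have h1 := hz y hy
  have h2 := hf.abs_sub_le hx (htK hy)
  rw [abs_le] at h1 h2 ⊢
  have h3 := dist_triangle_right z x y
  have h4 := dist_triangle z x y
  constructor <;> linarith [dist_comm x y, h1.1, h1.2, h2.1, h2.2]

-- Extend `f` by a value `c ≤ r` at `z` and realize the extension up to `δ`: the new point is then
-- within `c + δ` of `z`.
open Classical in
theorem HasApproxExtension.improve (hX : HasApproxExtension X) {K : Set X}
    (hK : TotallyBounded K) {f : X → ℝ} (hf : IsKatetovOn f K) {r δ : ℝ} (hr : 0 < r) (hδ : 0 < δ)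
    {z : X} (hz : ∀ x ∈ K, |dist z x - f x| ≤ r) :
    ∃ z', (∀ x ∈ K, |dist z' x - f x| ≤ δ) ∧ dist z z' ≤ r + δ := by
  -- The Katětov inequalities for the value `c` at `z` are that `c` lies between all `|dist z x - f
  -- x|` and all `dist z x + f x`. Including `0` and `r` gives `0 ≤ c ≤ r`, also when `K` is empty.
  obtain ⟨c, hc, hc'⟩ : ∃ c, (∀ a ∈ insert 0 ((fun x => |dist z x - f x|) '' K), a ≤ c) ∧
      ∀ b ∈ insert r ((fun x => dist z x + f x) '' K), c ≤ b := by
    refine exists_between_of_forall_le (Set.insert_nonempty _ _) (Set.insert_nonempty _ _) ?_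
    rintro _ (rfl | ⟨x, hx, rfl⟩) _ (rfl | ⟨y, hy, rfl⟩)
    · exact hr.le
    · have := hf.nonneg hy
      positivity
    · exact hz x hx
    · have h1 := hf x hx y hy
      have h2 := hf y hy x hx
      have := dist_triangle z y x
      have := dist_triangle_left x y z
      rw [dist_comm y x] at *
      exact abs_le.2 ⟨by linarith, by linarith⟩
  have hcK : ∀ x ∈ K, |dist z x - f x| ≤ c ∧ c ≤ dist z x + f x := fun x hx =>
    ⟨hc _ (Or.inr ⟨x, hx, rfl⟩), hc' _ (Or.inr ⟨x, hx, rfl⟩)⟩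
  have hcr : c ≤ r := hc' _ (Or.inl rfl)
  have hc0 : 0 ≤ c := hc _ (Or.inl rfl)
  -- When `z` already lies in `K`, the bounds at `z` pinch `c` to `f z`, so the update does not
  -- alter `f` on `K`.
  have hzK : z ∈ K → f z = c := fun h => by
    have := hcK z h
    rw [dist_self, zero_sub, abs_neg, abs_of_nonneg (hf.nonneg h)] at this
    linarith
  let g : X → ℝ := Function.update f z c
  have hgz : g z = c := Function.update_self _ _ _
  have hgK : ∀ x ∈ K, g x = f x := fun x hx => by
    by_cases h : x = z
    · subst h
      rw [hgz, hzK hx]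
    · exact Function.update_of_ne h _ _
  have hg : IsKatetovOn g (insert z K) := by
    rintro x (rfl | hx) y (rfl | hy)
    · rw [dist_self, hgz]
      exact ⟨by linarith, by linarith⟩
    · have := hcK y hy
      rw [abs_le] at this
      rw [hgz, hgK y hy]
      exact ⟨by linarith, by linarith⟩
    · have := hcK x hx
      rw [abs_le] at this
      rw [hgz, hgK x hx, dist_comm]
      exact ⟨by linarith, by linarith⟩
    · rw [hgK x hx, hgK y hy]
      exact hf x hx y hy
  obtain ⟨z', hz'⟩ := hX.of_totallyBounded (K := insert z K)
    (totallyBounded_insert z |>.2 hK) hg hδ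
  refine ⟨z', fun x hx => ?_, ?_⟩
  · rw [← hgK x hx]
    exact hz' x (Or.inr hx)
  · have := abs_le.1 (hz' z (Or.inl rfl))
    rw [hgz, dist_comm] at this
    linarith

/-- Improve the error from `2⁻ⁿ` to `2⁻ⁿ⁻¹` at each stage. The moves are at most `(3/2) · 2⁻ⁿ`, so
the points converge, and the limit has error zero. -/
theorem HasApproxExtension.exists_dist_eq [CompleteSpace X] (hX : HasApproxExtension X) {K : Set X}
    (hK : TotallyBounded K) {f : X → ℝ} (hf : IsKatetovOn f K) :
    ∃ z, ∀ x ∈ K, dist z x = f x := by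
  obtain ⟨s, hs, hs'⟩ := exists_seq_of_forall_exists
    (P := fun n z => ∀ x ∈ K, |dist z x - f x| ≤ (1 / 2 : ℝ) ^ n)
    (R := fun n z z' => dist z z' ≤ (1 / 2 : ℝ) ^ n + (1 / 2) ^ (n + 1))
    (hX.of_totallyBounded hK hf (by positivity))
    fun n z hz => hX.improve hK hf (by positivity) (by positivity) hz
  obtain ⟨z, hz⟩ := cauchySeq_tendsto_of_complete (cauchySeq_of_le_geometric (1 / 2) (3 / 2)
    (by norm_num) fun n => (hs' n).trans_eq (by ring))
  refine ⟨z, fun x hx => ?_⟩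
  have h1 : Filter.Tendsto (fun n => |dist (s n) x - f x|) Filter.atTop
      (nhds |dist z x - f x|) := ((hz.dist tendsto_const_nhds).sub tendsto_const_nhds).abs
  have h2 := tendsto_pow_atTop_nhds_zero_of_lt_one (show (0 : ℝ) ≤ 1 / 2 by norm_num)
    (by norm_num)
  have h3 := le_of_tendsto_of_tendsto' h1 h2 fun n => hs n x hx
  exact sub_eq_zero.1 (abs_nonpos_iff.1 h3)

end Katetov

/-! ### Extending isometric embeddings of compact spaces -/

section CompactExtension

variable {P U : Type*} [MetricSpace P] [MetricSpace U]

-- The distances to `p`, transported along `φ`, form a Katětov function on `φ '' K`. A point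
-- realizing it is the image of `p`.
open Classical in
theorem HasApproxExtension.exists_extend_insert [CompleteSpace U] (hU : HasApproxExtension U)
    {K : Set P} (hK : TotallyBounded K) {φ : P → U}
    (hφ : ∀ x ∈ K, ∀ y ∈ K, dist (φ x) (φ y) = dist x y) (p : P) :
    ∃ ψ : P → U, (∀ x ∈ insert p K, ∀ y ∈ insert p K, dist (ψ x) (ψ y) = dist x y) ∧
      Set.EqOn ψ φ K := by
  by_cases hp : p ∈ K
  · rw [Set.insert_eq_of_mem hp]
    exact ⟨φ, hφ, fun _ _ => rfl⟩
  have : Nonempty P := ⟨p⟩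
  have hinj : Set.InjOn φ K := fun x hx y hy h => by
    rw [← dist_eq_zero, ← hφ x hx y hy, h, dist_self]
  have hinv : ∀ x ∈ K, Function.invFunOn φ K (φ x) = x := fun x hx => hinj.leftInvOn_invFunOn hx
  obtain ⟨z, hz⟩ := hU.exists_dist_eq (K := φ '' K)
    (f := fun y => dist p (Function.invFunOn φ K y)) (by
      have h1 : TotallyBounded (Set.univ : Set K) := by
        simpa using totallyBounded_preimage (isUniformInducing_val K) hK
      have h2 : Isometry fun x : K => φ x := Isometry.of_dist_eq fun x y => hφ x x.2 y y.2
      have h3 := h1.image h2.uniformContinuous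
      rwa [Set.image_univ, ← Set.image_eq_range] at h3) (by
      rintro _ ⟨x, hx, rfl⟩ _ ⟨y, hy, rfl⟩
      simp only [hinv x hx, hinv y hy, hφ x hx y hy]
      have := dist_triangle_left x y p
      have := dist_triangle p y x
      exact ⟨by linarith [dist_comm x y], by linarith⟩)
  have hz' : ∀ x ∈ K, dist z (φ x) = dist p x := fun x hx => by
    rw [hz _ ⟨x, hx, rfl⟩, hinv x hx]
  have hne : ∀ x ∈ K, Function.update φ p z x = φ x := fun x hx =>
    Function.update_of_ne (ne_of_mem_of_not_mem hx hp) _ _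
  refine ⟨Function.update φ p z, ?_, hne⟩
  rintro x (rfl | hx) y (rfl | hy)
  · rw [dist_self, dist_self]
  · rw [hne y hy, Function.update_self, hz' y hy]
  · rw [hne x hx, Function.update_self, dist_comm, hz' x hx, dist_comm]
  · rw [hne x hx, hne y hy, hφ x hx y hy]

theorem exists_isometry_extend_of_dense [CompleteSpace U] {D : Set P} (hD : Dense D) {f : P → U}
    (hf : ∀ x ∈ D, ∀ y ∈ D, dist (f x) (f y) = dist x y) :
    ∃ ψ : P → U, Isometry ψ ∧ Set.EqOn ψ f D := by
  have hi : Isometry fun x : D => f x := Isometry.of_dist_eq fun x y => hf x x.2 y y.2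
  have hu : IsUniformInducing ((↑) : D → P) := isUniformInducing_val D
  have hr : DenseRange ((↑) : D → P) := hD.denseRange_val
  let ψ := (hu.isDenseInducing hr).extend fun x : D => f x
  have hψ : Continuous ψ :=
    (uniformContinuous_uniformly_extend hu hr hi.uniformContinuous).continuous
  have hψD : ∀ x : D, ψ x = f x := fun x =>
    uniformly_extend_of_ind hu hr hi.uniformContinuous x
  refine ⟨ψ, Isometry.of_dist_eq fun x y => ?_, fun x hx => hψD ⟨x, hx⟩⟩
  refine hr.induction_on₂ (p := fun x y => dist (ψ x) (ψ y) = dist x y) ?_ (fun x y => ?_) x y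
  · exact isClosed_eq (by fun_prop) (by fun_prop)
  · rw [hψD, hψD, hf x x.2 y y.2]

/-- Adjoin the terms of a dense sequence one by one to `K`. The successive extensions agree on
earlier stages, hence define an isometry on a dense set, which extends by completeness of `U`. -/
theorem HasApproxExtension.exists_isometry_extend [CompleteSpace U] (hU : HasApproxExtension U)
    [CompactSpace P] {K : Set P} {φ : P → U}
    (hφ : ∀ x ∈ K, ∀ y ∈ K, dist (φ x) (φ y) = dist x y) :
    ∃ ψ : P → U, Isometry ψ ∧ Set.EqOn ψ φ K := by
  rcases isEmpty_or_nonempty P with hP | hP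
  · exact ⟨φ, fun x => hP.elim x, fun _ _ => rfl⟩
  have htb : ∀ L : Set P, TotallyBounded L := fun L =>
    isCompact_univ.totallyBounded.subset (Set.subset_univ L)
  let p := denseSeq P
  let L : ℕ → Set P := fun n => p '' Set.Iio n ∪ K
  have hL0 : L 0 = K := by simp [L]
  have hL : ∀ n, L (n + 1) = insert (p n) (L n) := fun n => by
    simp only [L]
    rw [← Set.insert_union, ← Set.image_insert_eq]
    congr 2
    ext m
    simp only [Set.mem_Iio, Set.mem_insert_iff]
    omega
  have hmono : Monotone L := monotone_nat_of_le_succ fun n => by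
    rw [hL]
    exact Set.subset_insert _ _
  obtain ⟨s, hs, hs'⟩ := exists_seq_of_forall_exists
    (P := fun n ψ => (∀ x ∈ L n, ∀ y ∈ L n, dist (ψ x) (ψ y) = dist x y) ∧ Set.EqOn ψ φ K)
    (R := fun n ψ ψ' => Set.EqOn ψ' ψ (L n))
    ⟨φ, by rwa [hL0], fun _ _ => rfl⟩
    fun n ψ hψ => by
      obtain ⟨ψ', h1, h2⟩ := hU.exists_extend_insert (htb (L n)) hψ.1 (p n)
      refine ⟨ψ', ⟨by rwa [hL], fun x hx => ?_⟩, h2⟩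
      rw [h2 (Or.inr hx), hψ.2 hx]
  have hstab : ∀ n m, n ≤ m → Set.EqOn (s m) (s n) (L n) := fun n m h => by
    induction m, h using Nat.le_induction with
    | base => exact fun _ _ => rfl
    | succ m hm ih => exact fun x hx => (hs' m (hmono hm hx)).trans (ih hx)
  let D : Set P := ⋃ n, L n
  have hD : Dense D := (denseRange_denseSeq P).mono (by
    rintro _ ⟨n, rfl⟩
    exact Set.mem_iUnion.2 ⟨n + 1, Or.inl ⟨n, Nat.lt_succ_self n, rfl⟩⟩)
  choose! k hk using fun x (hx : x ∈ D) => Set.mem_iUnion.1 hx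
  have hf : ∀ n, ∀ x ∈ L n, s (k x) x = s n x := fun n x hx => by
    have hx' := hk x (Set.mem_iUnion.2 ⟨n, hx⟩)
    rcases le_total (k x) n with h | h
    · exact (hstab _ _ h hx').symm
    · exact hstab _ _ h hx
  obtain ⟨ψ, hψ, hψD⟩ := exists_isometry_extend_of_dense hD (f := fun x => s (k x) x)
    fun x hx y hy => by
      have h1 := hmono (le_max_left (k x) (k y)) (hk x hx)
      have h2 := hmono (le_max_right (k x) (k y)) (hk y hy)
      simp only [hf _ x h1, hf _ y h2]
      exact (hs _).1 x h1 y h2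
  refine ⟨ψ, hψ, fun x hx => ?_⟩
  have hx0 : x ∈ L 0 := Or.inr hx
  rw [hψD (Set.mem_iUnion.2 ⟨0, hx0⟩)]
  exact (hf 0 x hx0).trans ((hs 0).2 hx)

end CompactExtension

/-! ### Comparison with the Urysohn property -/

/-- The metric space obtained from `X` by adding a point at distances from the points of `X`
prescribed by a positive Katětov function. -/
@[reducible]
def optionMetricSpace {X : Type*} [MetricSpace X] (f : X → ℝ) (hf : IsKatetovOn f Set.univ)
    (h0 : ∀ x, f x ≠ 0) : MetricSpace (Option X) where
  dist a b := match a, b with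
    | none, none => 0
    | none, some x => f x
    | some x, none => f x
    | some x, some y => dist x y
  dist_self a := by rcases a with _ | x <;> simp
  dist_comm a b := by rcases a with _ | x <;> rcases b with _ | y <;> simp [dist_comm]
  dist_triangle a b c := by
    have h := fun x y => hf x trivial y trivial
    rcases a with _ | x <;> rcases b with _ | y <;> rcases c with _ | z <;> simp only
    · simp
    · simp
    · linarith [hf.nonneg (x := y) trivial]
    · linarith [h z y, dist_comm y z]
    · simp
    · exact (h x z).2
    · linarith [h x y]
    · exact dist_triangle x y z
  eq_of_dist_eq_zero {a b} e := by
    rcases a with _ | x <;> rcases b with _ | y <;> simp only at e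
    · rfl
    · exact absurd e (h0 y)
    · exact absurd e (h0 x)
    · rw [dist_eq_zero.1 e]

theorem IsUrysohn.hasApproxExtension {U : Met.{u}} (hU : IsUrysohn U) : HasApproxExtension U := by
  intro s f r hs hf hr
  suffices ∃ z, ∀ x ∈ s, dist z x = f x by
    obtain ⟨z, hz⟩ := this
    exact ⟨z, fun x hx => by rw [hz x hx, sub_self, abs_zero]; exact hr.le⟩
  -- A Katětov function vanishing at `z` is the distance to `z`. Otherwise it is positive, and
  -- adjoining a point gives a genuine metric to which the Urysohn property applies.
  by_cases h0 : ∃ x ∈ s, f x = 0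
  · obtain ⟨z, hz, h0⟩ := h0
    refine ⟨z, fun x hx => le_antisymm ?_ ?_⟩
    · linarith [(hf z hz x hx).2]
    · linarith [(hf x hx z hz).1, dist_comm z x]
  push Not at h0
  have : Finite s := hs
  let := optionMetricSpace (X := s) (fun x => f x) (fun x _ y _ => hf x x.2 y y.2)
    fun x => h0 x x.2
  obtain ⟨g, hg, hgi⟩ := hU.2.2 s (Option s) some (fun x => x)
    (Isometry.of_dist_eq fun _ _ => rfl) isometry_subtype_coe
  refine ⟨g none, fun x hx => ?_⟩
  have e : g (some ⟨x, hx⟩) = x := congrFun hgi ⟨x, hx⟩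
  rw [← e, hg.dist_eq]
  exact congrArg f e.symm

theorem HasApproxExtension.isUrysohn {U : Met.{u}} [SeparableSpace U] [CompleteSpace U]
    (hU : HasApproxExtension U) : IsUrysohn U := by
  refine ⟨inferInstance, inferInstance, fun A X _ _ _ _ i f hi hf => ?_⟩
  -- The empty Katětov datum shows that `U` is non-empty; `z` is a default value off the range of
  -- `i`.
  obtain ⟨z, -⟩ := hU ∅ (fun _ => 0) 1 Set.finite_empty (fun x hx => hx.elim) one_pos
  have he : ∀ a, Function.extend i f (fun _ => z) (i a) = f a := fun a =>
    hi.injective.extend_apply f _ a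
  obtain ⟨g, hg, hgi⟩ := hU.exists_isometry_extend (P := X) (K := Set.range i)
    (φ := Function.extend i f fun _ => z) (by
      rintro _ ⟨a, rfl⟩ _ ⟨b, rfl⟩
      rw [he, he, hf.dist_eq, hi.dist_eq])
  exact ⟨g, hg, funext fun a => (hgi ⟨a, rfl⟩).trans (he a)⟩

/-! ### Existence of the Urysohn space by Baire category -/

section GenericMetric

/-- The pseudometrics on `ℕ`. -/
def pseudometrics : Set (ℕ → ℕ → ℝ) :=
  {d | (∀ i, d i i = 0) ∧ (∀ i j, d i j = d j i) ∧ ∀ i j k, d i k ≤ d i j + d j k}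

theorem isClosed_pseudometrics : IsClosed pseudometrics := by
  simp only [pseudometrics, Set.ofPred_and, Set.ofPred_forall]
  refine (isClosed_iInter fun i => isClosed_eq (by fun_prop) (by fun_prop)).inter
    ((isClosed_iInter fun i => isClosed_iInter fun j =>
      isClosed_eq (by fun_prop) (by fun_prop)).inter
    (isClosed_iInter fun i => isClosed_iInter fun j => isClosed_iInter fun k =>
      isClosed_le (by fun_prop) (by fun_prop)))

/-- The values `L` on points of `ℕ` satisfy the Katětov inequalities up to `δ`. -/
def IsAlmostKatetov (d : ℕ → ℕ → ℝ) (L : Finset (ℕ × ℚ)) (δ : ℝ) : Prop :=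
  ∀ p ∈ L, ∀ q ∈ L, (p.2 : ℝ) - q.2 ≤ d p.1 q.1 + δ ∧ d p.1 q.1 ≤ p.2 + q.2 + δ

/-- Some point of `ℕ` has about the distances `L` from points of `ℕ`. -/
def IsAlmostRealized (d : ℕ → ℕ → ℝ) (L : Finset (ℕ × ℚ)) (δ : ℝ) : Prop :=
  ∃ m, ∀ p ∈ L, |d m p.1 - p.2| < 4 * δ

/-- The hypothesis consists of non-strict inequalities and so is closed; the conclusion consists of
strict ones and so is open. Each involves finitely many coordinates once the witness is fixed. -/
theorem isOpen_almostRealized (L : Finset (ℕ × ℚ)) (δ : ℝ) :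
    IsOpen {d : ℕ → ℕ → ℝ | IsAlmostKatetov d L δ → IsAlmostRealized d L δ} := by
  have : {d : ℕ → ℕ → ℝ | IsAlmostKatetov d L δ → IsAlmostRealized d L δ} =
      {d | IsAlmostKatetov d L δ}ᶜ ∪ {d | IsAlmostRealized d L δ} := Set.ext fun _ => imp_iff_not_or
  rw [this]
  refine (IsClosed.isOpen_compl (self := ?_)).union ?_
  · simp only [IsAlmostKatetov, Set.ofPred_forall, Set.ofPred_and]
    exact isClosed_biInter fun p _ => isClosed_biInter fun q _ =>
      (isClosed_le (by fun_prop) (by fun_prop)).inter (isClosed_le (by fun_prop) (by fun_prop))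
  · simp only [IsAlmostRealized, Set.ofPred_exists, Set.ofPred_forall]
    exact isOpen_iUnion fun m => isOpen_biInter_finset fun p _ =>
      isOpen_lt (by fun_prop) (by fun_prop)

theorem exists_katetov_of_isAlmostKatetov {d : ℕ → ℕ → ℝ} (hd : d ∈ pseudometrics)
    {L : Finset (ℕ × ℚ)} (hL : L.Nonempty) {δ : ℝ} (hδ : 0 < δ) (h : IsAlmostKatetov d L δ) :
    ∃ g : ℕ → ℝ, (∀ i j, g i ≤ d i j + g j) ∧ (∀ i j, d i j ≤ g i + g j) ∧
      ∀ p ∈ L, |g p.1 - p.2| < 4 * δ := by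
  obtain ⟨h0, hs, ht⟩ := hd
  -- The largest function with 1-Lipschitz growth from the data, raised by `2 * δ` to absorb the
  -- defect `δ` in the lower Katětov bound. The error on `L` remains below `4 * δ`.
  let g : ℕ → ℝ := fun i => L.inf' hL (fun p => (p.2 : ℝ) + d i p.1) + 2 * δ
  have hle : ∀ i, ∀ p ∈ L, g i ≤ p.2 + d i p.1 + 2 * δ := fun i p hp =>
    add_le_add_left (Finset.inf'_le (fun p : ℕ × ℚ => (p.2 : ℝ) + d i p.1) hp) _
  have hex : ∀ i, ∃ p ∈ L, g i = p.2 + d i p.1 + 2 * δ := fun i => by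
    obtain ⟨p, hp, e⟩ := Finset.exists_mem_eq_inf' hL (fun p : ℕ × ℚ => (p.2 : ℝ) + d i p.1)
    exact ⟨p, hp, congrArg (· + 2 * δ) e⟩
  refine ⟨g, fun i j => ?_, fun i j => ?_, fun p hp => ?_⟩
  · obtain ⟨p, hp, e⟩ := hex j
    linarith [hle i p hp, ht i j p.1]
  · obtain ⟨p, hp, e⟩ := hex i
    obtain ⟨q, hq, e'⟩ := hex j
    linarith [(h p hp q hq).2, ht i p.1 j, ht p.1 q.1 j, hs j q.1]
  · obtain ⟨q, hq, e⟩ := hex p.1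
    have h1 := hle p.1 p hp
    rw [h0] at h1
    rw [abs_lt]
    constructor <;> linarith [(h p hp q hq).1]

/-- The pseudometric `d` on the numbers below `n`, with all further numbers representing one point
at the distances `g`. -/
def cutoff (d : ℕ → ℕ → ℝ) (g : ℕ → ℝ) (n i j : ℕ) : ℝ :=
  if i < n then if j < n then d i j else g i else if j < n then g j else 0

theorem cutoff_mem {d : ℕ → ℕ → ℝ} (hd : d ∈ pseudometrics) {g : ℕ → ℝ}
    (h1 : ∀ i j, g i ≤ d i j + g j) (h2 : ∀ i j, d i j ≤ g i + g j) (n : ℕ) :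
    cutoff d g n ∈ pseudometrics := by
  obtain ⟨h0, hs, ht⟩ := hd
  have hg : ∀ i, 0 ≤ g i := fun i => by linarith [h2 i i, h0 i]
  refine ⟨fun i => ?_, fun i j => ?_, fun i j k => ?_⟩
  · by_cases h : i < n <;> simp [cutoff, h, h0]
  · simp only [cutoff]
    split_ifs <;> simp [hs i j]
  · simp only [cutoff]
    split_ifs
    all_goals linarith [ht i j k, h1 i j, h2 i k, h1 k j, hs j k, hg i, hg j, hg k]

theorem tendsto_cutoff (d : ℕ → ℕ → ℝ) (g : ℕ → ℝ) :
    Filter.Tendsto (cutoff d g) Filter.atTop (nhds d) := by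
  refine tendsto_pi_nhds.2 fun i => tendsto_pi_nhds.2 fun j => ?_
  refine tendsto_const_nhds.congr' ?_
  filter_upwards [Filter.eventually_gt_atTop i, Filter.eventually_gt_atTop j] with n hi hj
  simp [cutoff, hi, hj]

/-- Changing `d` only at numbers from `n` on gives pseudometrics converging to `d` pointwise. The
tail is free to represent a new point realizing `L`, once `n` exceeds all numbers in `L`. -/
theorem dense_almostRealized (L : Finset (ℕ × ℚ)) {δ : ℝ} (hδ : 0 < δ) :
    Dense {d : pseudometrics | IsAlmostKatetov d L δ → IsAlmostRealized d L δ} := by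
  rintro ⟨d, hd⟩
  by_cases h : IsAlmostKatetov d L δ
  · rcases L.eq_empty_or_nonempty with rfl | hL
    · exact subset_closure fun _ => ⟨0, by simp⟩
    obtain ⟨g, h1, h2, h3⟩ := exists_katetov_of_isAlmostKatetov hd hL hδ h
    refine mem_closure_of_tendsto (f := fun n => ⟨cutoff d g n, cutoff_mem hd h1 h2 n⟩)
      (tendsto_subtype_rng.2 (tendsto_cutoff d g)) ?_
    filter_upwards [(Finset.eventually_all L).2
      fun p _ => Filter.eventually_gt_atTop p.1] with n hn _
    refine ⟨n, fun p hp => ?_⟩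
    simpa [cutoff, hn p hp] using h3 p hp
  · exact subset_closure fun h' => absurd h' h

theorem exists_generic_pseudometric : ∃ d ∈ pseudometrics, ∀ (L : Finset (ℕ × ℚ)) (n : ℕ),
    IsAlmostKatetov d L (1 / (n + 1)) → IsAlmostRealized d L (1 / (n + 1)) := by
  -- A Polish space is Baire, and rational data and the tolerances `1 / (n + 1)` give only countably
  -- many conditions.
  have := isClosed_pseudometrics.polishSpace
  have hne : Nonempty pseudometrics := ⟨⟨0, by simp [pseudometrics]⟩⟩
  have := dense_iInter_of_isOpen (X := pseudometrics) (ι := Finset (ℕ × ℚ) × ℕ)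
    (f := fun k => {d | IsAlmostKatetov d k.1 (1 / (k.2 + 1)) →
      IsAlmostRealized d k.1 (1 / (k.2 + 1))})
    (fun k => (isOpen_almostRealized k.1 _).preimage continuous_subtype_val)
    (fun k => dense_almostRealized k.1 (by positivity))
  obtain ⟨d, hd⟩ := this.nonempty
  exact ⟨d, d.2, fun L n => Set.mem_iInter.1 hd (L, n)⟩

/-- The natural numbers with a pseudometric. -/
structure PseudometricNat (d : pseudometrics) : Type u where
  val : ℕ

instance (d : pseudometrics) : PseudoMetricSpace (PseudometricNat.{u} d) where
  dist x y := d.1 x.val y.val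
  dist_self _ := d.2.1 _
  dist_comm _ _ := d.2.2.1 _ _
  dist_triangle _ _ _ := d.2.2.2 _ _ _

instance (d : pseudometrics) : Countable (PseudometricNat.{u} d) :=
  Function.Injective.countable (f := PseudometricNat.val) fun ⟨_⟩ ⟨_⟩ h => congrArg _ h

-- Replace points of the completion by numbers and values of `f` by rationals, all up to `δ / 4`.
open UniformSpace in
theorem hasApproxExtension_completion {d : pseudometrics}
    (hd : ∀ (L : Finset (ℕ × ℚ)) (n : ℕ),
      IsAlmostKatetov d L (1 / (n + 1)) → IsAlmostRealized d L (1 / (n + 1))) :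
    HasApproxExtension (Completion (PseudometricNat.{u} d)) := by
  classical
  intro s f r hs hf hr
  -- The error `4 * δ` of the generic realization and twice `δ / 4` from the approximations stay
  -- below `5 * δ < r`.
  obtain ⟨n, hn⟩ := exists_nat_one_div_lt (show 0 < r / 5 by positivity)
  set δ : ℝ := 1 / (n + 1) with hδ
  have hδ0 : 0 < δ := by positivity
  have h1 : ∀ x : Completion (PseudometricNat.{u} d), ∃ i : ℕ,
      dist x (((⟨i⟩ : PseudometricNat.{u} d) : Completion _)) < δ / 4 := fun x => by
    obtain ⟨⟨i⟩, hi⟩ := Completion.denseRange_coe.exists_dist_lt x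
      (show 0 < δ / 4 by positivity)
    exact ⟨i, hi⟩
  choose i hi using h1
  choose q hq using fun x => exists_rat_near (f x) (show 0 < δ / 4 by positivity)
  have hd' : ∀ a b : ℕ, dist ((⟨a⟩ : PseudometricNat.{u} d) : Completion (PseudometricNat.{u} d))
      ((⟨b⟩ : PseudometricNat.{u} d) : Completion (PseudometricNat.{u} d)) = d.1 a b := fun a b =>
    Completion.dist_eq _ _
  have key : IsAlmostKatetov d (hs.toFinset.image fun x => (i x, q x)) δ := by
    intro p hp p' hp'
    obtain ⟨x, hx, rfl⟩ := Finset.mem_image.1 hp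
    obtain ⟨y, hy, rfl⟩ := Finset.mem_image.1 hp'
    rw [Set.Finite.mem_toFinset] at hx hy
    have e1 := abs_lt.1 (hq x)
    have e2 := abs_lt.1 (hq y)
    have e3 := hf x hx y hy
    have e4 := dist_triangle4 x ((⟨i x⟩ : PseudometricNat.{u} d) : Completion _)
      ((⟨i y⟩ : PseudometricNat.{u} d) : Completion _) y
    have e5 := dist_triangle4 ((⟨i x⟩ : PseudometricNat.{u} d) : Completion _) x y
      ((⟨i y⟩ : PseudometricNat.{u} d) : Completion _)
    rw [hd', dist_comm ((⟨i y⟩ : PseudometricNat.{u} d) : Completion _) y] at e4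
    rw [hd', dist_comm ((⟨i x⟩ : PseudometricNat.{u} d) : Completion _) x] at e5
    have h1 := hi x
    have h2 := hi y
    constructor <;> simp only <;> linarith
  obtain ⟨m, hm⟩ := hd _ n key
  refine ⟨((⟨m⟩ : PseudometricNat.{u} d) : Completion _), fun x hx => ?_⟩
  have e1 := abs_lt.1 (hm (i x, q x) (Finset.mem_image.2 ⟨x, hs.mem_toFinset.2 hx, rfl⟩))
  have e2 := abs_lt.1 (hq x)
  have hx' := hi x
  have e3 := dist_triangle_right ((⟨m⟩ : PseudometricNat.{u} d) : Completion _)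
    ((⟨i x⟩ : PseudometricNat.{u} d) : Completion _) x
  rw [dist_comm ((⟨i x⟩ : PseudometricNat.{u} d) : Completion _) x] at e3
  have e4 := dist_triangle ((⟨m⟩ : PseudometricNat.{u} d) : Completion _)
    ((⟨i x⟩ : PseudometricNat.{u} d) : Completion _) x
  rw [hd'] at e3 e4
  rw [dist_comm ((⟨i x⟩ : PseudometricNat.{u} d) : Completion _) x] at e4
  simp only [← hδ] at e1
  rw [abs_le]
  constructor <;> linarith

theorem exists_isUrysohn : ∃ U : Met.{u}, IsUrysohn U := by
  obtain ⟨d, hd, h⟩ := exists_generic_pseudometric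
  let U : Met.{u} := ⟨UniformSpace.Completion (PseudometricNat.{u} ⟨d, hd⟩)⟩
  have h1 : SeparableSpace U := UniformSpace.Completion.separableSpace_completion
  have h2 : CompleteSpace U := UniformSpace.Completion.completeSpace _
  exact ⟨U, HasApproxExtension.isUrysohn (hasApproxExtension_completion (d := ⟨d, hd⟩) h)⟩

end GenericMetric

/-! ### Functors on categories of elements with a terminal object -/

section Terminal

variable {C : Type u} [Category.{v} C] {𝒳 : BasedCategory.{v, max u v} C} {F : Cᵒᵖ ⥤ Type v}
  {D D' : el F ⥤ᵇ 𝒳} {x₀ : El F}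

theorem IsFibredInGroupoids.exists_iso_of_isTerminal (h𝒳 : IsFibredInGroupoids 𝒳)
    (h₀ : Limits.IsTerminal x₀) {σ : D.obj x₀ ⟶ D'.obj x₀} (hσ : 𝒳.p.IsHomLift (𝟙 x₀.base) σ) :
    ∃ τ : D ≅ D', τ.hom.toNatTrans.app x₀ = σ := by
  obtain ⟨τ, hτ⟩ := (isGlueing_of_isTerminal D h₀).exists_natTrans h𝒳
    (isGlueing_of_isTerminal D' h₀) hσ
  have := h𝒳.isIso_natTrans τ
  refine ⟨asIso τ, ?_⟩
  have h := hτ x₀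
  rw [h₀.hom_ext (h₀.from x₀) (𝟙 x₀), D.map_id, D'.map_id, Category.comp_id,
    Category.id_comp] at h
  exact h

theorem IsFibredInGroupoids.natTrans_ext_of_isTerminal (h𝒳 : IsFibredInGroupoids 𝒳)
    (h₀ : Limits.IsTerminal x₀) {τ τ' : D ⟶ D'}
    (h : τ.toNatTrans.app x₀ = τ'.toNatTrans.app x₀) : τ = τ' :=
  (isGlueing_of_isTerminal D' h₀).natTrans_ext h𝒳 fun x => by
    rw [← τ.toNatTrans.naturality, ← τ'.toNatTrans.naturality, h]

end Terminal

/-- A `T`-valued point of a metric space, as an object of the category of elements. -/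
abbrev ptOf {X : Met.{u}} {T : TBMet.{u}} (k : T.toMet ⟶ X) : El (hMet.obj X) := ⟨T, k⟩

/-- The morphism of points induced by a map of their sources. -/
abbrev ptOfMap {X : Met.{u}} {V T : TBMet.{u}} (f : V ⟶ T) (k : T.toMet ⟶ X) :
    ptOf (T := V) (TBMet.incl.map f ≫ k) ⟶ ptOf k := ⟨f, rfl⟩

/-- The identity of `T` is terminal in the category of elements of the presheaf represented by
`T`. -/
def isTerminalPtOf (T : TBMet.{u}) : Limits.IsTerminal (ptOf (𝟙 T.toMet)) :=
  Limits.IsTerminal.ofUniqueHom (fun x => ⟨x.elt, rfl⟩) fun _ m => Subtype.ext m.2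

/-- The space `2_r` as a totally bounded space. -/
def TBMet.two (r : ℝ) : TBMet.{u} :=
  ⟨MetricStacks.two r, (Set.toFinite _ : (Set.univ : Set (ULift.{u} _)).Finite).totallyBounded⟩

/-- The Urysohn chart. -/
abbrev chart (U : Met.{u}) : metStack (Cpt U) ⥤ᵇ GH.{u} :=
  BasedFunctor.comp (elMap (inCptIso U).inv) (subsetFamily U)

/-! ### Lifting along the Urysohn chart -/

section Chart

variable {U : Met.{u}} {T : TBMet.{u}} {P : GH.{u}.obj}

theorem IsProperSubmetry.compactSpace {P T : Met.{u}} [CompactSpace T] {q : P ⟶ T}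
    (h : IsProperSubmetry q) : CompactSpace P :=
  ⟨by simpa using h.2.isCompact_preimage isCompact_univ⟩

/-- The graph `{(j p, π p)}` in `U × T`, with `π` the projection of the family, is isometric to `P`
over `T`: as `π` is 1-Lipschitz, the maximum distance is the distance in `P`. -/
theorem exists_chart_of_isometry (hP : GH.{u}.p.obj P = T) {j : P.obj.total → U}
    (hj : Isometry j) :
    ∃ (k : T.toMet ⟶ Cpt U) (σ : (chart U).obj (ptOf k) ⟶ P),
      GH.{u}.p.IsHomLift (𝟙 T) σ ∧ (∀ t, Cpt.toSet (k t) = j '' (GH.projTo hP ⁻¹' {t})) ∧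
      ∀ z : unslice k, j (σ.hom.onTotal z) = z.1.1 := by
  let B : Set (U × T.toMet) := Set.range fun p => (j p, GH.projTo hP p)
  choose c hc using fun z : B => z.2
  have hjc : ∀ z : B, j (c z) = z.1.1 := fun z => congrArg Prod.fst (hc z)
  have hpc : ∀ z : B, GH.projTo hP (c z) = z.1.2 := fun z => congrArg Prod.snd (hc z)
  have hd : ∀ z z', dist (c z) (c z') = dist z.1.1 z'.1.1 := fun z z' => by
    rw [← hj.dist_eq, hjc, hjc]
  let φ : (⟨B⟩ : Met.{u}) ⟶ P.obj.total :=
    Met.Hom.mk c fun z z' => (hd z z').trans_le (le_max_left _ _)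
  have hφ : IsPullback φ (projSubset B) (GH.projTo hP) (TBMet.incl.map (𝟙 T)) := by
    refine Met.isPullback_of_dist hpc (fun z z' => ?_) fun p t e => ?_
    · exact max_le ((hd z z').symm.trans_le (le_max_left _ _)) (le_max_right _ _)
    · refine ⟨⟨_, ⟨p, rfl⟩⟩, hj.injective (hjc _), e⟩
  have hB : IsProperSubmetry (projSubset B) :=
    isProperSubmetry_of_isPullback hφ (GH.isProperSubmetry_projTo hP)
  obtain ⟨σ, hσ, hσφ⟩ := GH.exists_hom
    (P := (chart U).obj (ptOf (slices hB))) (V := T) rfl hP hφ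
  refine ⟨slices hB, σ, hσ, fun t => ?_, fun z => ?_⟩
  · ext x
    constructor
    · rintro ⟨p, hp⟩
      exact ⟨p, congrArg Prod.snd hp, congrArg Prod.fst hp⟩
    · rintro ⟨p, rfl, rfl⟩
      exact ⟨p, rfl⟩
  · rw [hσφ]
    exact hjc z

/-- Here `θ` identifies a compact subset of `U` with the fibre of `P` over the point `ι`. The
inverse isometry from this fibre into `U` extends to all of the compact space `P`, and the extension
yields the required map to `Cpt U`. -/
theorem exists_chart_extend (hU : IsUrysohn U) [CompactSpace T.toMet] (hP : GH.{u}.p.obj P = T)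
    {Y : El (hMet.obj (Cpt U))} (hY : Y.base = TBMet.pt) {ι : TBMet.pt ⟶ T}
    {θ : (chart U).obj Y ⟶ P} (hθ : GH.{u}.p.IsHomLift ι θ) :
    ∃ (k : T.toMet ⟶ Cpt U) (σ : (chart U).obj (ptOf k) ⟶ P)
      (b : ptOf (TBMet.incl.map ι ≫ k) ⟶ Y), GH.{u}.p.IsHomLift (𝟙 T) σ ∧
      (el (hMet.obj (Cpt U))).p.IsHomLift (𝟙 TBMet.pt) b ∧
      (chart U).map b ≫ θ = (chart U).map (ptOfMap ι k) ≫ σ := by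
  obtain ⟨V, l⟩ := Y
  obtain rfl : V = TBMet.pt := hY
  let l' : TBMet.pt.toMet ⟶ Cpt U := l
  let θ' : (⟨unslice l'⟩ : Met.{u}) ⟶ P.obj.total := θ.hom.onTotal
  have hpb : IsPullback θ' (projSubset (unslice l')) (GH.projTo hP)
    (TBMet.incl.map ι) := GH.isPullback (V := TBMet.pt) rfl hP hθ
  have hcomp : CompactSpace P.obj.total :=
    IsProperSubmetry.compactSpace (GH.isProperSubmetry_projTo hP)
  have hcU : CompleteSpace U := hU.2.1
  have hθd : ∀ a a' : unslice l', dist (θ' a) (θ' a') = dist a.1.1 a'.1.1 := fun a a' => by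
    have h1 := Met.dist_of_isPullback hpb a a'
    have h2 : dist (projSubset (unslice l') a) (projSubset (unslice l') a') = 0 :=
      dist_self (α := PUnit) _
    rw [h2, max_eq_left dist_nonneg] at h1
    refine h1.symm.trans ?_
    exact max_eq_left ((dist_self (α := PUnit) _).trans_le dist_nonneg)
  have hθi : Function.Injective θ' := fun a a' h => Met.eq_of_isPullback hpb h rfl
  obtain ⟨u, hu⟩ : (Cpt.toSet (l' PUnit.unit)).Nonempty := NonemptyCompacts.nonempty _
  have he : ∀ a, Function.extend θ' (fun a => a.1.1) (fun _ => u) (θ' a) = a.1.1 := fun a =>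
    hθi.extend_apply _ _ a
  obtain ⟨j, hj, hjθ⟩ := hU.hasApproxExtension.exists_isometry_extend (K := Set.range θ')
    (φ := Function.extend θ' (fun a => a.1.1) fun _ => u) (by
      rintro _ ⟨a, rfl⟩ _ ⟨a', rfl⟩
      rw [he, he, hθd])
  have hjθ' : ∀ a, j (θ' a) = a.1.1 := fun a => (hjθ ⟨a, rfl⟩).trans (he a)
  obtain ⟨k, σ, hσ, hk, hσj⟩ := exists_chart_of_isometry hP hj
  -- The extension restricts to the given embedding on the fibre, so the new family has the original
  -- subset as its slice, strictly and not only up to isometry.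
  have hkl : TBMet.incl.map ι ≫ k = l' := Met.hom_ext fun t => by
    refine Cpt.ext ((hk _).trans ?_)
    ext x
    constructor
    · rintro ⟨p, hp, rfl⟩
      obtain ⟨a, rfl, ha⟩ := Met.exists_of_isPullback hpb hp
      rw [hjθ']
      exact a.2
    · intro hx
      refine ⟨θ' ⟨(x, t), hx⟩, ?_, hjθ' _⟩
      exact DFunLike.congr_fun hpb.w _
  let b : ptOf (TBMet.incl.map ι ≫ k) ⟶ ptOf l' := ⟨𝟙 TBMet.pt, hkl.symm⟩
  have hb : (el (hMet.obj (Cpt U))).p.IsHomLift (𝟙 TBMet.pt) b :=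
    Functor.IsHomLift.map (p := (el (hMet.obj (Cpt U))).p) b
  refine ⟨k, σ, b, hσ, hb, ?_⟩
  have h1 : GH.{u}.p.IsHomLift (𝟙 TBMet.pt) ((chart U).map b) :=
    BasedFunctor.preserves_isHomLift (chart U) _ b
  have h2 : GH.{u}.p.IsHomLift ι ((chart U).map (ptOfMap ι k)) :=
    isHomLift_el_map (chart U) (ptOfMap ι k)
  refine GH.hom_ext (f := ι) inferInstance inferInstance fun z => hj.injective ?_
  let z₁ : unslice l' := ((chart U).map b).hom.onTotal z
  let z₂ : unslice k := ((chart U).map (ptOfMap ι k)).hom.onTotal z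
  exact (hjθ' z₁).trans (hσj z₂).symm

theorem chart_isFormalSubmetry (hU : IsUrysohn U) : 
    IsFormalSubmetry (elMap (inCptIso U).inv ≫ subsetFamily U) := by
  refine ⟨⟨fun (y : metStack pt ⥤ᵇ GH.{u}) => ?_⟩, fun r s hs hr x g α => ?_⟩
  · have hP := y.w_obj (ptOf (𝟙 TBMet.pt.toMet))
    have : CompactSpace TBMet.pt.toMet := inferInstanceAs (CompactSpace PUnit)
    have := IsProperSubmetry.compactSpace (GH.isProperSubmetry_projTo hP)
    have hcU : CompleteSpace U := hU.2.1
    obtain ⟨z, -⟩ := hU.hasApproxExtension ∅ (fun _ => 0) 1 Set.finite_empty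
      (fun x hx => hx.elim) one_pos
    -- Extending from the empty set embeds any compact space in `U`; this is essential surjectivity
    -- on points.
    obtain ⟨j, hj, -⟩ := hU.hasApproxExtension.exists_isometry_extend (K := ∅)
      (φ := fun _ : (y.obj (ptOf (𝟙 TBMet.pt.toMet))).obj.total => z) fun x hx => hx.elim
    obtain ⟨k, σ, hσ, -⟩ := exists_chart_of_isometry hP hj
    obtain ⟨τ, -⟩ := GH.isFibredInGroupoids.exists_iso_of_isTerminal
      (D := BasedFunctor.comp (metStackMap k) (chart U)) (D' := y) (isTerminalPtOf TBMet.pt) hσ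
    exact ⟨metStackMap k, ⟨τ⟩⟩
  · have h𝒢 := GH.isFibredInGroupoids.{u}
    have hM := (isStackInGroupoids_metStack (Cpt U)).1
    let ι : TBMet.pt.{u} ⟶ TBMet.two.{u} s :=
      (iotaZero.{u} r ≫ iota.{u} hs hr : pt.{u} ⟶ MetricStacks.two.{u} s)
    have : CompactSpace (TBMet.two.{u} s).toMet :=
      have : Finite (TBMet.two.{u} s).toMet := inferInstanceAs (Finite (ULift.{u} ({0, s} : Set ℝ)))
      inferInstance
    let z₀ := ptOf (𝟙 TBMet.pt.{u}.toMet)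
    let x₀ := ptOf (𝟙 (TBMet.two.{u} s).toMet)
    have hz₀ : Limits.IsTerminal z₀ := isTerminalPtOf _
    have hx₀ : Limits.IsTerminal x₀ := isTerminalPtOf _
    let x' : metStack pt.{u} ⥤ᵇ metStack (Cpt U) := x
    let g' : metStack (two.{u} s) ⥤ᵇ GH.{u} := g
    let e : ptOf (T := TBMet.pt) (TBMet.incl.map ι ≫ 𝟙 _) ⟶ x₀ := ptOfMap ι (𝟙 _)
    let α₀ : (chart U).obj (x'.obj z₀) ⟶ g'.obj (ptOf (T := TBMet.pt) (TBMet.incl.map ι ≫ 𝟙 _)) :=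
      α.hom.toNatTrans.app z₀
    have hα₀ : GH.{u}.p.IsHomLift (𝟙 TBMet.pt) α₀ := α.hom.isHomLift' z₀
    have hge : GH.{u}.p.IsHomLift ι (g'.map e) := isHomLift_el_map g' e
    have hθ : GH.{u}.p.IsHomLift (𝟙 TBMet.pt ≫ ι) (α₀ ≫ g'.map e) :=
      @IsHomLift.comp _ _ _ _ GH.{u}.p _ _ _ _ _ _ (𝟙 TBMet.pt) ι α₀ (g'.map e) hα₀ hge
    rw [Category.id_comp] at hθ
    obtain ⟨k, σ, b, hσ, hb, hbσ⟩ := exists_chart_extend hU (g'.w_obj x₀) (x'.w_obj z₀) hθ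
    obtain ⟨γ, hγ⟩ := h𝒢.exists_iso_of_isTerminal
      (D := BasedFunctor.comp (metStackMap k) (chart U)) (D' := g') hx₀ (σ := σ) hσ
    -- The lift `k` exists already over `2_s`, without loss of distance; `h` is its restriction
    -- along `ι_{rs}`.
    let h : metStack (two.{u} r) ⟶ metStack (Cpt U) := metStackMap (iota.{u} hs hr) ≫ metStackMap k
    obtain ⟨β, hβ⟩ := hM.exists_iso_of_isTerminal
      (D := metStackMap (iotaZero.{u} r) ≫ h) (D' := x) hz₀ (σ := b) hb
    let γ' : metStackMap k ≫ elMap (inCptIso U).inv ≫ subsetFamily U ≅ g := γ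
    refine ⟨h, β, α_ _ _ _ ≪≫ whiskerLeftIso _ γ', ?_⟩
    refine h𝒢.natTrans_ext_of_isTerminal hz₀ ?_
    let γ₀ : (chart U).obj (ptOf (TBMet.incl.map ι ≫ k)) ⟶
        g'.obj (ptOf (T := TBMet.pt) (TBMet.incl.map ι ≫ 𝟙 _)) :=
      γ.hom.toNatTrans.app (ptOf (T := TBMet.pt) (TBMet.incl.map ι ≫ 𝟙 _))
    have hγ₀ : GH.{u}.p.IsHomLift (𝟙 TBMet.pt) γ₀ :=
      γ.hom.isHomLift' (ptOf (T := TBMet.pt) (TBMet.incl.map ι ≫ 𝟙 _))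
    have hb₀ : GH.{u}.p.IsHomLift (𝟙 TBMet.pt) ((chart U).map b) :=
      BasedFunctor.preserves_isHomLift (chart U) _ b
    -- The identity of 2-morphisms at the terminal object. Composing with the cartesian arrow
    -- `g'.map e` reduces it to the compatibility of `σ` with `θ`.
    have key : (chart U).map b ≫ α₀ = γ₀ := by
      refine h𝒢.hom_ext hge (@IsHomLift.comp_of_lift_id _ _ _ _ GH.{u}.p _ _ _ _ _ _ hb₀ hα₀)
        hγ₀ ((Category.assoc _ _ _).trans (hbσ.trans ?_))
      exact (congrArg ((chart U).map (ptOfMap ι k) ≫ ·) hγ.symm).trans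
        (γ.hom.toNatTrans.naturality e)
    change (chart U).map (β.hom.toNatTrans.app z₀) ≫ α₀ =
      𝟙 _ ≫ (𝟙 _ ≫ γ₀) ≫ 𝟙 _
    exact (congrArg (fun t => (chart U).map t ≫ α₀) hβ).trans (key.trans
      ((Category.id_comp _).trans ((Category.comp_id _).trans (Category.id_comp _))).symm)


end Chart

end

end MetricStacks

theorem mainTheorem4 :
    (∃ U : Met.{u}, IsUrysohn U) ∧
    IsStackInGroupoids lsm GH.{u} ∧
    (∀ U : Met.{u}, IsUrysohn U →
      IsStackInGroupoids lsm (el (inCpt U)) ∧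
      IsStackInGroupoids lsm (metStack (Cpt U)) ∧
      ∃ η : inCpt U ≅ hMet.obj (Cpt U),
        (∀ (T : TBMet.{u}) (A : (inCpt U).obj (op T)) (t : T.toMet),
          Cpt.toSet (evalAt (η.hom.app (op T) A) t) = {x : U | (x, t) ∈ A.1}) ∧
        IsFormalSubmetry (elMap η.inv ≫ subsetFamily U)) ∧
    IsNaiveMetricStack GH.{u} := by
  obtain ⟨U, hU⟩ := exists_isUrysohn.{u}
  exact ⟨⟨U, hU⟩, GH.isStackInGroupoids, fun V hV => ⟨isStackInGroupoids_inCpt V,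
    isStackInGroupoids_metStack _, inCptIso V, fun _ A t => toSet_inCptIso V A t,
    chart_isFormalSubmetry hV⟩, GH.isStackInGroupoids, Cpt U, _, chart_isFormalSubmetry hU⟩
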